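/- For $n\ge 1$ and $\theta\in\mathbb R^n$ let $\mathbb E_\theta$ denote expectation under $X\sim N(\theta,I_n)$. For a non-empty closed convex set $\Theta\subseteq\mathbb R^n$ let $\mathcal F(\Theta)$ be the class of real-valued convex functions $f$ on $\Theta$ that are bounded below on $\Theta$ and for which the minimum of $\alpha\mapsto\frac12\|x-\alpha\|_2^2+f(\alpha)$ over $\Theta$ is attained for every $x\in\mathbb R^n$ (the latter holds, for instance, when $f$ is lower semicontinuous on $\Theta$). For $f\in\mathcal F(\Theta)$ let $$\widehat\theta(X;\Theta,f):=\operatorname*{argmin}_{\alpha\in\Theta}\Big(\tfrac12\|X-\alpha\|_2^2+f(\alpha)\Big)$$ be the penalized least squares estimator, and define the normalized minimax risk $$R_{\mathrm{nm}}(\Theta;f):=\inf_{\delta}\ \sup_{\theta\in\Theta}\ \frac{\mathbb E_\theta\|\delta(X)-\theta\|_2^2}{\mathbb E_\theta\|\widehat\theta(X;\Theta,f)-\theta\|_2^2},$$ where the infimum is over all estimators, i.e. measurable maps $\delta:\mathbb R^n\to\mathbb R^n$, with the conventions $\frac00=1$ and $\frac a0=+\infty$ for $a>0$. Let $$C^*:=\inf_{n\ge1}\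 \inf_{\Theta}\ \inf_{f\in\mathcal F(\Theta)}R_{\mathrm{nm}}(\Theta;f),$$ where $\Theta$ ranges over all non-empty closed convex subsets of $\mathbb R^n$. Then $$6.05\times10^{-6}\ \le\ C^*\ \le\ \tfrac12 .$$ -/

import Mathlib

open MeasureTheory ProbabilityTheory
open scoped ENNReal

noncomputable section

namespace GaussianSequence

/-- The law `N(θ, Iₙ)` of the observation `X`. -/
def law {n : ℕ} (θ : EuclideanSpace ℝ (Fin n)) : Measure (EuclideanSpace ℝ (Fin n)) :=
  multivariateGaussian θ 1

/-- The risk `E_θ ‖δ(X) - θ‖²`, with values in `[0, ∞]`. -/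
def risk {n : ℕ} (δ : EuclideanSpace ℝ (Fin n) → EuclideanSpace ℝ (Fin n))
    (θ : EuclideanSpace ℝ (Fin n)) : ℝ≥0∞ :=
  ∫⁻ x, ‖δ x - θ‖ₑ ^ 2 ∂(law θ)

/-- `a` minimizes `α ↦ ‖x - α‖² / 2 + f α` over `Θ`. -/
def IsPenalizedMin {n : ℕ} (Θ : Set (EuclideanSpace ℝ (Fin n)))
    (f : EuclideanSpace ℝ (Fin n) → ℝ) (x a : EuclideanSpace ℝ (Fin n)) : Prop :=
  a ∈ Θ ∧ IsMinOn (fun α => 1 / 2 * ‖x - α‖ ^ 2 + f α) Θ a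

/-- The closed convex parameter sets in `ℝⁿ` (non-empty, as parameter sets are). -/
def parameterSets (n : ℕ) : Set (Set (EuclideanSpace ℝ (Fin n))) :=
  {Θ | IsClosed Θ ∧ Convex ℝ Θ ∧ Θ.Nonempty}

/-- The convex penalties on `Θ` (only the values on `Θ` matter): real-valued convex functions on
`Θ`, bounded below on `Θ`, for which the penalized least squares problem has a solution for every
observation `x` (automatic, for instance, if `f` is lower semicontinuous on `Θ`). -/
def penalties {n : ℕ} (Θ : Set (EuclideanSpace ℝ (Fin n))) :
    Set (EuclideanSpace ℝ (Fin n) → ℝ) :=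
  {f | ConvexOn ℝ Θ f ∧ BddBelow (f '' Θ) ∧ ∀ x, ∃ a, IsPenalizedMin Θ f x a}

open Classical in
/-- The penalized least squares estimator, `argmin_{α ∈ Θ} (‖x - α‖² / 2 + f α)`. For
`f ∈ penalties Θ` the minimizer exists and, by strict convexity, is unique. -/
def penalizedLSE {n : ℕ} (Θ : Set (EuclideanSpace ℝ (Fin n)))
    (f : EuclideanSpace ℝ (Fin n) → ℝ) (x : EuclideanSpace ℝ (Fin n)) :
    EuclideanSpace ℝ (Fin n) :=
  if h : ∃ a, IsPenalizedMin Θ f x a then h.choose else 0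

open Classical in
/-- Quotient of risks with the conventions `0 / 0 = 1` and `a / 0 = ∞` for `a > 0`. -/
def riskRatio (r s : ℝ≥0∞) : ℝ≥0∞ :=
  if r = 0 ∧ s = 0 then 1 else r / s

/-- The normalized minimax risk over `Θ`; estimators are the measurable maps `ℝⁿ → ℝⁿ`. -/
def normalizedMinimaxRisk {n : ℕ} (Θ : Set (EuclideanSpace ℝ (Fin n)))
    (f : EuclideanSpace ℝ (Fin n) → ℝ) : ℝ≥0∞ :=
  ⨅ (δ : EuclideanSpace ℝ (Fin n) → EuclideanSpace ℝ (Fin n)) (_ : Measurable δ),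
    ⨆ θ ∈ Θ, riskRatio (risk δ θ) (risk (penalizedLSE Θ f) θ)

/-- The universal constant `C*`. -/
def Cstar : ℝ≥0∞ :=
  ⨅ (n : ℕ) (_ : 1 ≤ n), ⨅ Θ ∈ parameterSets n, ⨅ f ∈ penalties Θ, normalizedMinimaxRisk Θ f

end GaussianSequence

end

/-! Lower bound. The penalized estimator is a proximal map, hence `1`-Lipschitz, and moving the true
mean by `h` changes its error by at most `‖h‖`; so its risk varies slowly with the parameter
(`risk_penalizedLSE_le`). It therefore suffices to work near one well-chosen `θ₀ ∈ Θ`, taken with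
bias at most `1`. Such a point exists because replacing `θ` by the mean of the estimator is a
gradient step for the Gaussian-smoothed Moreau envelope, which is bounded below
(`exists_norm_meanLSE_sub_le_one`). Let `r ^ 2` be the risk of the estimator at `θ₀`.

If `r = 0`, the conventions for the ratio suffice. If `0 < r ≤ 85`, some value of the estimator lies
at distance at least `r` from `θ₀`, so `Θ` contains a segment of length `min 1 r` from `θ₀`, and a
two-point argument applies (`exists_lt_risk_of_le`).

If `r ≥ 85`, the prior is the law of the estimator under `θ₀`, contracted towards `θ₀` by the factor
`1 / 20` (`exists_lt_risk_of_ge`). An estimator `δ` with small risk at a typical prior point `w`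
must, even under `N(θ₀, I)`, fall near `w` with probability at least `exp (-0.01 r²) / 2`
(`ofReal_exp_le_measure`). Yet Gaussian concentration of the Lipschitz estimator, together with its
small bias, makes every ball of radius `r / 40` have prior mass at most `2 exp (-0.032 r²)`
(`measure_le_half_le`). Integrating over both variables and exchanging the order contradicts this.

Upper bound. On `[-a, a]` with zero penalty and `a → 0`, least squares jumps to `±a` with
probability near `1 / 2` each, so its risk is about `a ^ 2 + θ ^ 2 ≥ 2 θ ^ 2`, whereas the estimator
`0` has risk `θ ^ 2`. -/

namespace GaussianSequence

open Real
open scoped RealInnerProductSpace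

/-! ### Gaussian density, translation and likelihood ratios -/

section Density

variable {ι : Type*} [Fintype ι]

/-- The density of the standard Gaussian measure with respect to Lebesgue measure. -/
noncomputable def stdDensity (x : EuclideanSpace ℝ ι) : ℝ :=
  (√(2 * π))⁻¹ ^ Fintype.card ι * exp (-‖x‖ ^ 2 / 2)

lemma stdDensity_nonneg (x : EuclideanSpace ℝ ι) : 0 ≤ stdDensity x := by
  unfold stdDensity; positivity

@[fun_prop]
lemma measurable_stdDensity : Measurable (stdDensity (ι := ι)) := by
  unfold stdDensity; fun_prop

lemma stdDensity_toLp (x : ι → ℝ) :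
    stdDensity (WithLp.toLp 2 x) = ∏ i, gaussianPDFReal 0 1 (x i) := by
  simp [stdDensity, gaussianPDFReal, Finset.prod_mul_distrib, ← exp_sum,
    EuclideanSpace.real_norm_sq_eq, Finset.sum_neg_distrib, Finset.sum_div, neg_div]

lemma pi_gaussianReal_eq_withDensity :
    Measure.pi (fun _ : ι ↦ gaussianReal 0 1) =
      volume.withDensity (fun x ↦ ENNReal.ofReal (∏ i, gaussianPDFReal 0 1 (x i))) := by
  refine Measure.pi_eq fun s hs ↦ ?_
  rw [withDensity_apply _ (MeasurableSet.univ_pi hs), volume_pi, Measure.restrict_pi_pi,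
    ← ofReal_integral_eq_lintegral_ofReal]
  · rw [integral_fintype_prod_eq_prod (f := fun _ x ↦ gaussianPDFReal 0 1 x),
      ENNReal.ofReal_prod_of_nonneg]
    · refine Finset.prod_congr rfl fun i _ ↦ ?_
      rw [gaussianReal_apply_eq_integral _ one_ne_zero]
    · exact fun i _ ↦ integral_nonneg fun x ↦ gaussianPDFReal_nonneg _ _ _
  · exact Integrable.fintype_prod fun i ↦ (integrable_gaussianPDFReal 0 1).restrict
  · exact Filter.Eventually.of_forall fun x ↦
      Finset.prod_nonneg fun i _ ↦ gaussianPDFReal_nonneg _ _ _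

lemma stdGaussian_eq_withDensity :
    stdGaussian (EuclideanSpace ℝ ι) =
      volume.withDensity (fun x ↦ ENNReal.ofReal (stdDensity x)) := by
  rw [← map_pi_eq_stdGaussian, pi_gaussianReal_eq_withDensity]
  ext s hs
  rw [Measure.map_apply (by fun_prop) hs, withDensity_apply _ hs, withDensity_apply _
    ((WithLp.measurable_toLp 2 _) hs), ← (PiLp.volume_preserving_toLp ι).setLIntegral_comp_preimage
      hs (by fun_prop)]
  simp_rw [stdDensity_toLp]

lemma lintegral_stdGaussian {g : EuclideanSpace ℝ ι → ℝ≥0∞} (hg : Measurable g) :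
    ∫⁻ z, g z ∂stdGaussian (EuclideanSpace ℝ ι) = ∫⁻ z, ENNReal.ofReal (stdDensity z) * g z := by
  rw [stdGaussian_eq_withDensity, lintegral_withDensity_eq_lintegral_mul _ (by fun_prop) hg]
  rfl

lemma stdGaussian_absolutelyContinuous :
    stdGaussian (EuclideanSpace ℝ ι) ≪ volume := by
  rw [stdGaussian_eq_withDensity]
  exact withDensity_absolutelyContinuous _ _

/-- The likelihood ratio of `N(h, I)` with respect to `N(0, I)`. -/
noncomputable def likelihood (h z : EuclideanSpace ℝ ι) : ℝ := exp (⟪h, z⟫ - ‖h‖ ^ 2 / 2)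

lemma likelihood_pos (h z : EuclideanSpace ℝ ι) : 0 < likelihood h z := exp_pos _

@[fun_prop]
lemma measurable_likelihood (h : EuclideanSpace ℝ ι) : Measurable (likelihood h) := by
  unfold likelihood; fun_prop

lemma stdDensity_mul_likelihood (h z : EuclideanSpace ℝ ι) :
    stdDensity z * likelihood h z = stdDensity (z - h) := by
  rw [stdDensity, stdDensity, likelihood, mul_assoc, ← exp_add, norm_sub_sq_real,
    real_inner_comm]
  ring_nf

/-- Translating the standard Gaussian measure amounts to weighting it by the likelihood ratio. -/
lemma lintegral_stdGaussian_add (h : EuclideanSpace ℝ ι) {g : EuclideanSpace ℝ ι → ℝ≥0∞}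
    (hg : Measurable g) :
    ∫⁻ z, g (h + z) ∂stdGaussian (EuclideanSpace ℝ ι) =
      ∫⁻ z, ENNReal.ofReal (likelihood h z) * g z ∂stdGaussian (EuclideanSpace ℝ ι) := by
  rw [lintegral_stdGaussian (by fun_prop), lintegral_stdGaussian (by fun_prop),
    ← lintegral_add_left_eq_self (fun z ↦ ENNReal.ofReal (stdDensity z) *
      (ENNReal.ofReal (likelihood h z) * g z)) h]
  refine lintegral_congr fun z ↦ ?_
  rw [← mul_assoc, ← ENNReal.ofReal_mul (stdDensity_nonneg _), stdDensity_mul_likelihood,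
    add_sub_cancel_left]

lemma lintegral_likelihood (h : EuclideanSpace ℝ ι) :
    ∫⁻ z, ENNReal.ofReal (likelihood h z) ∂stdGaussian (EuclideanSpace ℝ ι) = 1 := by
  simpa using (lintegral_stdGaussian_add h (g := fun _ ↦ 1) measurable_const).symm

/-- The square of the likelihood for `h` is `exp (‖h‖ ^ 2)` times the likelihood for `2h`, which
integrates to `1`. -/
lemma lintegral_likelihood_sq (h : EuclideanSpace ℝ ι) :
    ∫⁻ z, ENNReal.ofReal (likelihood h z ^ 2) ∂stdGaussian (EuclideanSpace ℝ ι) =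
      ENNReal.ofReal (exp (‖h‖ ^ 2)) := by
  have (z : EuclideanSpace ℝ ι) : likelihood h z ^ 2 =
      exp (‖h‖ ^ 2) * likelihood ((2 : ℝ) • h) z := by
    rw [likelihood, likelihood, ← exp_nat_mul, ← exp_add, inner_smul_left, norm_smul]
    congr 1
    simp
    ring
  simp_rw [this, ENNReal.ofReal_mul (exp_pos _).le]
  rw [lintegral_const_mul _ (by fun_prop), lintegral_likelihood, mul_one]

lemma lintegral_exp_inner (h : EuclideanSpace ℝ ι) :
    ∫⁻ z, ENNReal.ofReal (exp ⟪h, z⟫) ∂stdGaussian (EuclideanSpace ℝ ι) =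
      ENNReal.ofReal (exp (‖h‖ ^ 2 / 2)) := by
  have (z : EuclideanSpace ℝ ι) : exp ⟪h, z⟫ = exp (‖h‖ ^ 2 / 2) * likelihood h z := by
    rw [likelihood, ← exp_add]; ring_nf
  simp_rw [this, ENNReal.ofReal_mul (exp_pos _).le]
  rw [lintegral_const_mul _ (by fun_prop), lintegral_likelihood, mul_one]

lemma law_eq_map {n : ℕ} (θ : EuclideanSpace ℝ (Fin n)) :
    law θ = (stdGaussian (EuclideanSpace ℝ (Fin n))).map (fun z ↦ θ + z) := by
  simp [law, multivariateGaussian]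

end Density

/-! ### Gaussian concentration by rotation -/

section Concentration

variable {ι : Type*} [Fintype ι] {F : EuclideanSpace ℝ ι → ℝ}

lemma lipschitzWith_arc (x y : EuclideanSpace ℝ ι) :
    LipschitzWith (‖x‖₊ + ‖y‖₊) (fun t : ℝ ↦ cos t • x + sin t • y) := by
  have hc : LipschitzWith 1 cos := lipschitzWith_cos
  have hs : LipschitzWith 1 sin := lipschitzWith_sin
  refine LipschitzWith.of_dist_le_mul fun s t ↦ ?_
  have h1 := hc.dist_le_mul s t
  have h2 := hs.dist_le_mul s t
  rw [Real.dist_eq] at h1 h2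
  have : cos s • x + sin s • y - (cos t • x + sin t • y) =
      (cos s - cos t) • x + (sin s - sin t) • y := by module
  rw [dist_eq_norm, this]
  refine (norm_add_le _ _).trans ?_
  rw [norm_smul, norm_smul, Real.norm_eq_abs, Real.norm_eq_abs]
  push_cast at h1 h2 ⊢
  nlinarith [norm_nonneg x, norm_nonneg y]

lemma hasDerivAt_arc (x y : EuclideanSpace ℝ ι) (t : ℝ) :
    HasDerivAt (fun t : ℝ ↦ cos t • x + sin t • y) (-sin t • x + cos t • y) t :=
  ((hasDerivAt_cos t).smul_const x).add ((hasDerivAt_sin t).smul_const y)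

/-- Jensen's inequality for `exp`, applied to the increment of `φ` written as the average over `(0,
T]` of `T * deriv φ`; Lipschitz functions are absolutely continuous, so this holds without
differentiability everywhere. -/
lemma exp_average_le {φ : ℝ → ℝ} {K : NNReal} (hφ : LipschitzWith K φ) {T : ℝ} (hT : 0 < T) :
    ENNReal.ofReal (exp (φ T - φ 0)) ≤
      ENNReal.ofReal T⁻¹ * ∫⁻ t in Set.Ioc 0 T, ENNReal.ofReal (exp (T * deriv φ t)) := by
  have hftc : ∫ t in (0 : ℝ)..T, deriv φ t = φ T - φ 0 :=
    hφ.lipschitzOnWith.absolutelyContinuousOnInterval.integral_deriv_eq_sub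
  rw [intervalIntegral.integral_of_le hT.le] at hftc
  have hb (t : ℝ) : ‖T * deriv φ t‖ ≤ T * K := by
    rw [norm_mul, Real.norm_of_nonneg hT.le]
    exact mul_le_mul_of_nonneg_left (norm_deriv_le_of_lipschitz hφ) hT.le
  have hm : Measurable (fun t ↦ T * deriv φ t) := (measurable_deriv φ).const_mul T
  have hi : IntegrableOn (fun t ↦ T * deriv φ t) (Set.Ioc 0 T) :=
    Measure.integrableOn_of_bounded (by simp) hm.aestronglyMeasurable
      (Filter.Eventually.of_forall hb)
  have hie : IntegrableOn (fun t ↦ exp (T * deriv φ t)) (Set.Ioc 0 T) := by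
    refine Measure.integrableOn_of_bounded (M := exp (T * K)) (by simp)
      (measurable_exp.comp hm).aestronglyMeasurable (Filter.Eventually.of_forall fun t ↦ ?_)
    rw [Real.norm_of_nonneg (exp_pos _).le]
    exact exp_le_exp.2 ((le_abs_self _).trans (hb t))
  have : NeZero (volume.restrict (Set.Ioc 0 T)) := ⟨by
    rw [Ne, Measure.restrict_eq_zero]; simp [hT]⟩
  have hJ := convexOn_exp.map_average_le continuous_exp.continuousOn isClosed_univ
    (Filter.Eventually.of_forall fun _ ↦ Set.mem_univ _) hi hie
  rw [setAverage_eq, setAverage_eq, integral_const_mul, hftc] at hJ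
  simp only [Measure.real, Real.volume_Ioc, sub_zero, ENNReal.toReal_ofReal hT.le,
    smul_eq_mul] at hJ
  rw [inv_mul_cancel_left₀ hT.ne'] at hJ
  rw [← ofReal_integral_eq_lintegral_ofReal hie (Filter.Eventually.of_forall fun t ↦ (exp_pos _).le),
    ← ENNReal.ofReal_mul (by positivity)]
  exact ENNReal.ofReal_le_ofReal hJ

lemma measurable_fderiv_apply_prod :
    Measurable (fun p : EuclideanSpace ℝ ι × EuclideanSpace ℝ ι ↦ fderiv ℝ F p.1 p.2) := by
  classical
  have (p : EuclideanSpace ℝ ι × EuclideanSpace ℝ ι) : fderiv ℝ F p.1 p.2 =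
      ∑ i, p.2 i * fderiv ℝ F p.1 (EuclideanSpace.basisFun ι ℝ i) := by
    conv_lhs => rw [← (EuclideanSpace.basisFun ι ℝ).sum_repr p.2]
    simp
  simp_rw [this]
  refine Finset.measurable_sum _ fun i _ ↦ Measurable.mul (by fun_prop) ?_
  exact (measurable_fderiv_apply_const ℝ F _).comp measurable_fst

/-- For fixed `x` the derivative is the inner product with a gradient of norm at most `1`, so this
is a Gaussian moment generating function. -/
lemma lintegral_exp_fderiv_le (hF : LipschitzWith 1 F) (c : ℝ) (x : EuclideanSpace ℝ ι) :
    ∫⁻ y, ENNReal.ofReal (exp (c * fderiv ℝ F x y)) ∂stdGaussian (EuclideanSpace ℝ ι) ≤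
      ENNReal.ofReal (exp (c ^ 2 / 2)) := by
  have h1 : ‖fderiv ℝ F x‖ ≤ 1 := norm_fderiv_le_of_lipschitz ℝ hF
  set g := (InnerProductSpace.toDual ℝ (EuclideanSpace ℝ ι)).symm (fderiv ℝ F x) with hg
  have h2 (y) : c * fderiv ℝ F x y = ⟪c • g, y⟫ := by
    rw [inner_smul_left, hg, InnerProductSpace.toDual_symm_apply]; simp
  simp_rw [h2]
  rw [lintegral_exp_inner]
  refine ENNReal.ofReal_le_ofReal (exp_le_exp.2 ?_)
  have h3 : ‖g‖ ≤ 1 := by rw [hg, LinearIsometryEquiv.norm_map]; exact h1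
  rw [norm_smul, mul_pow, Real.norm_eq_abs, sq_abs]
  nlinarith [sq_nonneg c, norm_nonneg g, pow_le_one₀ (norm_nonneg g) h3 (n := 2)]

lemma map_rotation_stdGaussian (t : ℝ) :
    ((stdGaussian (EuclideanSpace ℝ ι)).prod (stdGaussian (EuclideanSpace ℝ ι))).map
      (ContinuousLinearMap.rotation t) =
    (stdGaussian (EuclideanSpace ℝ ι)).prod (stdGaussian (EuclideanSpace ℝ ι)) :=
  IsGaussian.map_rotation_eq_self_of_forall_strongDual_eq_zero integral_strongDual_stdGaussian t

/-- For each fixed angle the rotated point is again standard Gaussian, so Rademacher's theorem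
applies; Fubini then exchanges the order of the two "almost every". -/
lemma ae_ae_differentiableAt_arc (hF : LipschitzWith 1 F) :
    ∀ᵐ p ∂(stdGaussian (EuclideanSpace ℝ ι)).prod (stdGaussian (EuclideanSpace ℝ ι)),
      ∀ᵐ t ∂(volume : Measure ℝ), DifferentiableAt ℝ F (ContinuousLinearMap.rotation t p).1 := by
  have hcont : Continuous (fun q : (EuclideanSpace ℝ ι × EuclideanSpace ℝ ι) × ℝ ↦
      (ContinuousLinearMap.rotation q.2 q.1).1) := by
    simp only [ContinuousLinearMap.rotation_apply]; fun_prop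
  rw [Measure.ae_ae_comm (p := fun p t ↦ DifferentiableAt ℝ F (ContinuousLinearMap.rotation t p).1)
    (hcont.measurable (measurableSet_of_differentiableAt ℝ F))]
  refine Filter.Eventually.of_forall fun t ↦ ?_
  have h0 : ∀ᵐ x ∂stdGaussian (EuclideanSpace ℝ ι), DifferentiableAt ℝ F x :=
    stdGaussian_absolutelyContinuous.ae_le hF.ae_differentiableAt
  have h1 : ∀ᵐ q ∂(stdGaussian (EuclideanSpace ℝ ι)).prod (stdGaussian (EuclideanSpace ℝ ι)),
      DifferentiableAt ℝ F q.1 := Measure.quasiMeasurePreserving_fst.ae h0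
  rw [← map_rotation_stdGaussian t] at h1
  exact ae_of_ae_map (p := fun q ↦ DifferentiableAt ℝ F q.1)
    (ContinuousLinearMap.rotation t).continuous.aemeasurable h1

/-- **Maurey–Pisier inequality**: exponential moments of the increment of a `1`-Lipschitz function
between two independent standard Gaussian vectors. -/
theorem lintegral_exp_sub_le (hF : LipschitzWith 1 F) (c : ℝ) :
    ∫⁻ p, ENNReal.ofReal (exp (c * (F p.2 - F p.1)))
      ∂(stdGaussian (EuclideanSpace ℝ ι)).prod (stdGaussian (EuclideanSpace ℝ ι)) ≤
      ENNReal.ofReal (exp (c ^ 2 * π ^ 2 / 8)) := by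
  set γ := stdGaussian (EuclideanSpace ℝ ι) with hγ
  set H : EuclideanSpace ℝ ι × EuclideanSpace ℝ ι → ℝ≥0∞ :=
    fun p ↦ ENNReal.ofReal (exp (π / 2 * c * fderiv ℝ F p.1 p.2)) with hH
  have hHm : Measurable H :=
    (measurable_exp.comp (measurable_fderiv_apply_prod.const_mul _)).ennreal_ofReal
  have hcont : Continuous (fun q : (EuclideanSpace ℝ ι × EuclideanSpace ℝ ι) × ℝ ↦
      ContinuousLinearMap.rotation q.2 q.1) := by
    simp only [ContinuousLinearMap.rotation_apply]; fun_prop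
  have hpt : ∀ᵐ p ∂γ.prod γ, ENNReal.ofReal (exp (c * (F p.2 - F p.1))) ≤
      ENNReal.ofReal (π / 2)⁻¹ *
        ∫⁻ t in Set.Ioc 0 (π / 2), H (ContinuousLinearMap.rotation t p) := by
    filter_upwards [ae_ae_differentiableAt_arc hF] with p hp
    -- The quarter circle joins `p.1` to `p.2`, and its point and velocity at angle `t` are the two
    -- components of the rotated pair.
    set φ : ℝ → ℝ := fun t ↦ c * F (cos t • p.1 + sin t • p.2) with hφ
    have hL : LipschitzWith (‖c‖₊ * (1 * (‖p.1‖₊ + ‖p.2‖₊))) φ :=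
      (LipschitzWith.of_dist_le_mul fun a b ↦ by
        simp [dist_eq_norm, ← mul_sub, norm_mul] : LipschitzWith ‖c‖₊ (fun s : ℝ ↦ c * s)).comp
        (hF.comp (lipschitzWith_arc p.1 p.2))
    have key := exp_average_le hL (T := π / 2) (by positivity)
    have e : φ (π / 2) - φ 0 = c * (F p.2 - F p.1) := by simp [hφ, mul_sub]
    rw [e] at key
    refine key.trans (mul_le_mul_right (le_of_eq ?_) _)
    refine lintegral_congr_ae (ae_restrict_of_ae ?_)
    filter_upwards [hp] with t ht
    have hd : HasDerivAt φ (c * fderiv ℝ F (ContinuousLinearMap.rotation t p).1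
        (ContinuousLinearMap.rotation t p).2) t :=
      (ht.hasFDerivAt.comp_hasDerivAt t (hasDerivAt_arc p.1 p.2 t)).const_mul c
    rw [hd.deriv, hH]
    simp only [mul_assoc]
  calc _ ≤ ∫⁻ p, (ENNReal.ofReal (π / 2)⁻¹ *
        ∫⁻ t in Set.Ioc 0 (π / 2), H (ContinuousLinearMap.rotation t p)) ∂γ.prod γ :=
      lintegral_mono_ae hpt
    _ = ENNReal.ofReal (π / 2)⁻¹ *
        ∫⁻ t in Set.Ioc 0 (π / 2), ∫⁻ p, H (ContinuousLinearMap.rotation t p) ∂γ.prod γ := by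
      rw [lintegral_const_mul' _ _ ENNReal.ofReal_ne_top]
      congr 1
      exact lintegral_lintegral_swap (hHm.comp hcont.measurable).aemeasurable
    _ ≤ ENNReal.ofReal (π / 2)⁻¹ *
        ∫⁻ t in Set.Ioc 0 (π / 2), ENNReal.ofReal (exp (c ^ 2 * π ^ 2 / 8)) := by
      gcongr with t
      -- By rotation invariance point and velocity are independent standard Gaussians at every
      -- angle, so the inner integral no longer depends on `t`.
      rw [← lintegral_map hHm (by fun_prop), map_rotation_stdGaussian t,
        lintegral_prod _ hHm.aemeasurable]
      refine (lintegral_mono fun x ↦ lintegral_exp_fderiv_le hF (π / 2 * c) x).trans ?_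
      rw [lintegral_const, measure_univ, mul_one]
      exact le_of_eq (by ring_nf)
    _ = ENNReal.ofReal (exp (c ^ 2 * π ^ 2 / 8)) := by
      rw [setLIntegral_const, Real.volume_Ioc, sub_zero, mul_comm (ENNReal.ofReal (exp _)),
        ← mul_assoc, ← ENNReal.ofReal_mul (by positivity), inv_mul_cancel₀ (by positivity)]
      simp

end Concentration

/-! ### Small-ball estimates for Lipschitz functions -/

section Tails

variable {ι : Type*} [Fintype ι] {F : EuclideanSpace ℝ ι → ℝ}

lemma lintegral_sub_sq_le (hF : LipschitzWith 1 F) :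
    ∫⁻ p, ENNReal.ofReal ((F p.2 - F p.1) ^ 2)
      ∂(stdGaussian (EuclideanSpace ℝ ι)).prod (stdGaussian (EuclideanSpace ℝ ι)) ≤ 32 := by
  have hFm : Measurable F := hF.continuous.measurable
  have hexp : exp (1 ^ 2 * π ^ 2 / 8) ≤ 8 := by
    have h1 : (1 ^ 2 * π ^ 2 / 8 : ℝ) ≤ 2 := by nlinarith [pi_lt_d2, pi_pos]
    have h2 : exp 2 = exp 1 * exp 1 := by rw [← exp_add]; norm_num
    have h3 := exp_one_lt_d9
    refine (exp_le_exp.2 h1).trans ?_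
    rw [h2]
    nlinarith [exp_pos 1]
  have hpt (d : ℝ) : d ^ 2 ≤ 2 * (exp (1 * d) + exp (-1 * d)) := by
    have h1 := quadratic_le_exp_of_nonneg (abs_nonneg d)
    have h2 : exp |d| ≤ exp (1 * d) + exp (-1 * d) := by
      rcases abs_cases d with ⟨h, _⟩ | ⟨h, _⟩ <;> rw [h] <;> simp [exp_nonneg]
    nlinarith [abs_nonneg d, sq_abs d]
  calc _ ≤ ∫⁻ p, 2 * (ENNReal.ofReal (exp (1 * (F p.2 - F p.1))) +
        ENNReal.ofReal (exp (-1 * (F p.2 - F p.1))))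
        ∂(stdGaussian (EuclideanSpace ℝ ι)).prod (stdGaussian (EuclideanSpace ℝ ι)) := by
        refine lintegral_mono fun p ↦ ?_
        refine (ENNReal.ofReal_le_ofReal (hpt _)).trans_eq ?_
        rw [ENNReal.ofReal_mul (by norm_num), ENNReal.ofReal_add (by positivity) (by positivity)]
        simp
    _ ≤ 2 * (ENNReal.ofReal 8 + ENNReal.ofReal 8) := by
        rw [lintegral_const_mul _ (by fun_prop), lintegral_add_left (by fun_prop)]
        gcongr
        · exact (lintegral_exp_sub_le hF 1).trans (ENNReal.ofReal_le_ofReal hexp)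
        · refine (lintegral_exp_sub_le hF (-1)).trans (ENNReal.ofReal_le_ofReal ?_)
          rwa [neg_one_sq, ← one_pow 2]
    _ = 32 := by
        rw [← ENNReal.ofReal_add (by norm_num) (by norm_num), ← ENNReal.ofReal_ofNat 2,
          ← ENNReal.ofReal_mul (by norm_num), ← ENNReal.ofReal_ofNat 32]
        norm_num

lemma measure_le_mul_measure_ge_le (hF : LipschitzWith 1 F) {s t : ℝ} (hst : s ≤ t) :
    stdGaussian (EuclideanSpace ℝ ι) {z | F z ≤ s} *
      stdGaussian (EuclideanSpace ℝ ι) {z | t ≤ F z} ≤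
      ENNReal.ofReal (exp (-((t - s) ^ 2 / 5))) := by
  have hFm : Measurable F := hF.continuous.measurable
  have h1 : MeasurableSet {z | F z ≤ s} := measurableSet_le hFm measurable_const
  have h2 : MeasurableSet {z | t ≤ F z} := measurableSet_le measurable_const hFm
  -- Chernoff parameter minimizing `-c (t - s) + (10 / 8) c ^ 2`, where `10` bounds `π ^ 2`.
  set c := 2 / 5 * (t - s) with hc
  have hc0 : 0 ≤ c := by rw [hc]; linarith
  rw [← Measure.prod_prod, ← lintegral_indicator_one (h1.prod h2)]
  calc _ ≤ ∫⁻ p, ENNReal.ofReal (exp (-(c * (t - s)))) *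
        ENNReal.ofReal (exp (c * (F p.2 - F p.1)))
        ∂(stdGaussian (EuclideanSpace ℝ ι)).prod (stdGaussian (EuclideanSpace ℝ ι)) := by
        refine lintegral_mono fun p ↦ ?_
        by_cases hp : p ∈ {z | F z ≤ s} ×ˢ {z | t ≤ F z}
        swap
        · rw [Set.indicator_of_notMem hp]; exact zero_le
        rw [Set.indicator_of_mem hp, ← ENNReal.ofReal_mul (exp_pos _).le, ← exp_add,
          Pi.one_apply, ENNReal.one_le_ofReal,
          one_le_exp_iff]
        have := hp.1
        have := hp.2
        simp only [Set.mem_ofPred_eq] at *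
        nlinarith
    _ ≤ ENNReal.ofReal (exp (-(c * (t - s)))) * ENNReal.ofReal (exp (c ^ 2 * π ^ 2 / 8)) := by
        rw [lintegral_const_mul _ (by fun_prop)]
        gcongr
        exact lintegral_exp_sub_le hF c
    _ ≤ _ := by
        rw [← ENNReal.ofReal_mul (exp_pos _).le, ← exp_add]
        refine ENNReal.ofReal_le_ofReal (exp_le_exp.2 ?_)
        have hpi : π ^ 2 ≤ 10 := by nlinarith [pi_lt_d2, pi_pos]
        have : c ^ 2 * π ^ 2 ≤ c ^ 2 * 10 := by gcongr
        rw [hc] at this ⊢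
        nlinarith

/-- A nonnegative `1`-Lipschitz function with large second moment is very unlikely to be small. -/
lemma measure_le_half_le (hF : LipschitzWith 1 F) (hF0 : ∀ z, 0 ≤ F z) {r : ℝ} (hr : 85 ≤ r)
    (h2 : ENNReal.ofReal (r ^ 2 - 1) ≤
      ∫⁻ z, ENNReal.ofReal (F z ^ 2) ∂stdGaussian (EuclideanSpace ℝ ι)) :
    stdGaussian (EuclideanSpace ℝ ι) {z | F z ≤ r / 2} ≤
      2 * ENNReal.ofReal (exp (-(0.032 * r ^ 2))) := by
  set γ := stdGaussian (EuclideanSpace ℝ ι) with hγ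
  have hFm : Measurable F := hF.continuous.measurable
  set t := 9 / 10 * r with ht
  have hA : MeasurableSet {z | t ≤ F z} := measurableSet_le measurable_const hFm
  have hD := lintegral_sub_sq_le hF
  rw [← hγ, lintegral_prod _ (by fun_prop)] at hD
  -- If `F y` is below `t = 9r / 10`, the second moment of `F` forces a mean squared deviation from
  -- `F y` of at least `64`; the average over `y` is at most `32`, so this happens with probability
  -- at most `1 / 2`. The numbers need `0.01 r ^ 2 ≥ 64.1`, which `r ≥ 85` provides.
  have hin (y) (hy : y ∈ {z | t ≤ F z}ᶜ) :
      32 * 2 ≤ ∫⁻ x, ENNReal.ofReal ((F x - F y) ^ 2) ∂γ := by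
    simp only [Set.mem_compl_iff, Set.mem_ofPred_eq, not_le] at hy
    have hpt (x) : 1 / 10 * F x ^ 2 ≤ (F x - F y) ^ 2 + t ^ 2 / 9 := by
      have : F y ^ 2 ≤ t ^ 2 := by have := hF0 y; gcongr
      nlinarith [sq_nonneg (9 / 10 * F x - F y)]
    have h3 : ENNReal.ofReal (1 / 10) * ENNReal.ofReal (r ^ 2 - 1) ≤
        ∫⁻ x, ENNReal.ofReal ((F x - F y) ^ 2) ∂γ + ENNReal.ofReal (t ^ 2 / 9) := by
      calc _ ≤ ENNReal.ofReal (1 / 10) * ∫⁻ z, ENNReal.ofReal (F z ^ 2) ∂γ := by gcongr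
        _ = ∫⁻ z, ENNReal.ofReal (1 / 10 * F z ^ 2) ∂γ := by
          rw [← lintegral_const_mul _ (by fun_prop)]
          simp_rw [← ENNReal.ofReal_mul (show (0 : ℝ) ≤ 1 / 10 by norm_num)]
        _ ≤ ∫⁻ x, (ENNReal.ofReal ((F x - F y) ^ 2) + ENNReal.ofReal (t ^ 2 / 9)) ∂γ := by
          refine lintegral_mono fun x ↦ ?_
          rw [← ENNReal.ofReal_add (by positivity) (by positivity)]
          exact ENNReal.ofReal_le_ofReal (hpt x)
        _ = _ := by
          rw [lintegral_add_right _ measurable_const, lintegral_const, hγ, measure_univ, mul_one]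
    rw [← ENNReal.ofReal_mul (by norm_num)] at h3
    have h4 : ENNReal.ofReal 64 + ENNReal.ofReal (t ^ 2 / 9) ≤
        ENNReal.ofReal (1 / 10 * (r ^ 2 - 1)) := by
      rw [← ENNReal.ofReal_add (by norm_num) (by positivity)]
      refine ENNReal.ofReal_le_ofReal ?_
      rw [ht]; nlinarith
    have h5 := (ENNReal.add_le_add_iff_right ENNReal.ofReal_ne_top).1 (h4.trans h3)
    refine le_trans (le_of_eq ?_) h5
    rw [ENNReal.ofReal_ofNat]; norm_num
  have hAc : γ {z | t ≤ F z}ᶜ * 2 ≤ 1 := by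
    have : 32 * (γ {z | t ≤ F z}ᶜ * 2) ≤ 32 * 1 := by
      calc 32 * (γ {z | t ≤ F z}ᶜ * 2) = ∫⁻ _ in {z | t ≤ F z}ᶜ, 32 * 2 ∂γ := by
            rw [setLIntegral_const]; ring
        _ ≤ ∫⁻ y in {z | t ≤ F z}ᶜ, ∫⁻ x, ENNReal.ofReal ((F x - F y) ^ 2) ∂γ ∂γ :=
            setLIntegral_mono' hA.compl hin
        _ ≤ ∫⁻ y, ∫⁻ x, ENNReal.ofReal ((F x - F y) ^ 2) ∂γ ∂γ := setLIntegral_le_lintegral _ _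
        _ ≤ 32 * 1 := by simpa using hD
    exact (ENNReal.mul_le_mul_iff_right (by norm_num) (by norm_num)).1 this
  have hA2 : 1 ≤ 2 * γ {z | t ≤ F z} := by
    have h6 : γ {z | t ≤ F z} + γ {z | t ≤ F z}ᶜ = 1 := by
      rw [measure_add_measure_compl hA, hγ, measure_univ]
    have h7 : (1 : ℝ≥0∞) + 1 ≤ 2 * γ {z | t ≤ F z} + 1 := by
      calc (1 : ℝ≥0∞) + 1 = 2 * (γ {z | t ≤ F z} + γ {z | t ≤ F z}ᶜ) := by
            rw [h6]; norm_num
        _ = 2 * γ {z | t ≤ F z} + γ {z | t ≤ F z}ᶜ * 2 := by ring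
        _ ≤ _ := by gcongr
    exact (ENNReal.add_le_add_iff_right ENNReal.one_ne_top).1 h7
  have hprod := measure_le_mul_measure_ge_le hF (s := r / 2) (t := t) (by rw [ht]; linarith)
  calc γ {z | F z ≤ r / 2} ≤ γ {z | F z ≤ r / 2} * (2 * γ {z | t ≤ F z}) :=
        le_mul_of_one_le_right' hA2
    _ = 2 * (γ {z | F z ≤ r / 2} * γ {z | t ≤ F z}) := by ring
    _ ≤ 2 * ENNReal.ofReal (exp (-((t - r / 2) ^ 2 / 5))) := by gcongr
    _ = _ := by rw [ht]; ring_nf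

end Tails

/-! ### Penalized least squares as a proximal map -/

section Prox

variable {n : ℕ} {Θ : Set (EuclideanSpace ℝ (Fin n))} {f : EuclideanSpace ℝ (Fin n) → ℝ}

lemma isPenalizedMin_penalizedLSE (hf : f ∈ penalties Θ) (x : EuclideanSpace ℝ (Fin n)) :
    IsPenalizedMin Θ f x (penalizedLSE Θ f x) := by
  rw [penalizedLSE, dif_pos (hf.2.2 x)]
  exact (hf.2.2 x).choose_spec

lemma penalizedLSE_mem (hf : f ∈ penalties Θ) (x : EuclideanSpace ℝ (Fin n)) :
    penalizedLSE Θ f x ∈ Θ := (isPenalizedMin_penalizedLSE hf x).1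

/-- The variational inequality characterizing penalized least squares. -/
lemma inner_le_of_isPenalizedMin (hf : ConvexOn ℝ Θ f) {x a α : EuclideanSpace ℝ (Fin n)}
    (ha : IsPenalizedMin Θ f x a) (hα : α ∈ Θ) : ⟪x - a, α - a⟫ ≤ f α - f a := by
  by_contra! hcon
  set g := ⟪x - a, α - a⟫ - (f α - f a) with hg
  have hg0 : 0 < g := by rw [hg]; linarith
  set N := ‖α - a‖ ^ 2 with hN
  have hN0 : 0 ≤ N := by positivity
  -- Competitor on the segment from `a` to `α`: the first-order gain is `t * g`, and this `t` is
  -- small enough for the quadratic loss `t ^ 2 * N / 2` not to cancel it.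
  set t := g / (g + N) with ht
  have ht0 : 0 < t := by positivity
  have ht1 : t ≤ 1 := by rw [ht, div_le_one (by positivity)]; linarith
  have htN : t * N < g := by
    rw [ht, div_mul_eq_mul_div, div_lt_iff₀ (by positivity)]
    nlinarith
  have hmem : (1 - t) • a + t • α ∈ Θ := hf.1 ha.1 hα (by linarith) ht0.le (by ring)
  have hfc : f ((1 - t) • a + t • α) ≤ (1 - t) * f a + t * f α :=
    hf.2 ha.1 hα (by linarith) ht0.le (by ring)
  have hmin : 1 / 2 * ‖x - a‖ ^ 2 + f a ≤
    1 / 2 * ‖x - ((1 - t) • a + t • α)‖ ^ 2 + f ((1 - t) • a + t • α) := ha.2 hmem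
  have hexp : ‖x - ((1 - t) • a + t • α)‖ ^ 2 =
      ‖x - a‖ ^ 2 - 2 * (t * ⟪x - a, α - a⟫) + t ^ 2 * N := by
    have : x - ((1 - t) • a + t • α) = (x - a) - t • (α - a) := by module
    rw [this, norm_sub_sq_real, inner_smul_right, norm_smul, mul_pow, Real.norm_eq_abs, sq_abs]
  rw [hexp] at hmin
  have : t * (g - t * N / 2) ≤ 0 := by rw [hg]; nlinarith
  nlinarith

/-- Firm nonexpansiveness: add the variational inequalities at `x` and `y`, each tested against the
other minimizer; the penalty terms cancel. -/
lemma norm_sq_penalizedLSE_sub_le (hf : f ∈ penalties Θ) (x y : EuclideanSpace ℝ (Fin n)) :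
    ‖penalizedLSE Θ f x - penalizedLSE Θ f y‖ ^ 2 ≤
      ⟪penalizedLSE Θ f x - penalizedLSE Θ f y, x - y⟫ := by
  have h1 := inner_le_of_isPenalizedMin hf.1 (isPenalizedMin_penalizedLSE hf x)
    (penalizedLSE_mem hf y)
  have h2 := inner_le_of_isPenalizedMin hf.1 (isPenalizedMin_penalizedLSE hf y)
    (penalizedLSE_mem hf x)
  generalize penalizedLSE Θ f x = a at *
  generalize penalizedLSE Θ f y = b at *
  have h3 : ⟪x - a, b - a⟫ + ⟪y - b, a - b⟫ = ‖a - b‖ ^ 2 - ⟪a - b, x - y⟫ := by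
    rw [← real_inner_self_eq_norm_sq]
    simp only [inner_sub_left, inner_sub_right]
    linarith [real_inner_comm a b, real_inner_comm a x, real_inner_comm b x, real_inner_comm a y,
      real_inner_comm b y]
  linarith

lemma lipschitzWith_penalizedLSE (hf : f ∈ penalties Θ) : LipschitzWith 1 (penalizedLSE Θ f) := by
  refine LipschitzWith.of_dist_le_mul fun x y ↦ ?_
  rw [NNReal.coe_one, one_mul, dist_eq_norm, dist_eq_norm]
  have h := (norm_sq_penalizedLSE_sub_le hf x y).trans (real_inner_le_norm _ _)
  by_contra! hlt
  nlinarith [norm_nonneg (x - y)]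

/-- The residual map is also nonexpansive, so that moving the mean by `w - θ` changes the error of
the estimator by at most `‖w - θ‖`. -/
lemma norm_penalizedLSE_add_sub_le (hf : f ∈ penalties Θ) (θ w z : EuclideanSpace ℝ (Fin n)) :
    ‖penalizedLSE Θ f (w + z) - w‖ ≤ ‖penalizedLSE Θ f (θ + z) - θ‖ + ‖w - θ‖ := by
  set a := penalizedLSE Θ f (w + z)
  set b := penalizedLSE Θ f (θ + z)
  have h := norm_sq_penalizedLSE_sub_le hf (w + z) (θ + z)
  have e : w + z - (θ + z) = w - θ := by abel
  rw [e] at h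
  have h2 : ‖(a - b) - (w - θ)‖ ≤ ‖w - θ‖ := by
    refine abs_le_of_sq_le_sq' ?_ (norm_nonneg _) |>.2
    rw [norm_sub_sq_real]
    nlinarith [sq_nonneg ‖a - b‖]
  calc ‖a - w‖ = ‖(b - θ) + ((a - b) - (w - θ))‖ := by congr 1; abel
    _ ≤ _ := (norm_add_le _ _).trans (by gcongr)

lemma measurable_penalizedLSE (hf : f ∈ penalties Θ) : Measurable (penalizedLSE Θ f) :=
  (lipschitzWith_penalizedLSE hf).continuous.measurable

lemma risk_eq_lintegral {δ : EuclideanSpace ℝ (Fin n) → EuclideanSpace ℝ (Fin n)}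
    (hδ : Measurable δ) (θ : EuclideanSpace ℝ (Fin n)) :
    risk δ θ = ∫⁻ z, ENNReal.ofReal (‖δ (θ + z) - θ‖ ^ 2)
      ∂stdGaussian (EuclideanSpace ℝ (Fin n)) := by
  rw [risk, law_eq_map, lintegral_map (by fun_prop) (by fun_prop)]
  refine lintegral_congr fun z ↦ ?_
  rw [← ofReal_norm, ENNReal.ofReal_pow (norm_nonneg _)]

lemma memLp_penalizedLSE (hf : f ∈ penalties Θ) (θ : EuclideanSpace ℝ (Fin n)) :
    MemLp (fun z ↦ penalizedLSE Θ f (θ + z)) 2 (stdGaussian (EuclideanSpace ℝ (Fin n))) := by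
  have h1 : MemLp (fun z : EuclideanSpace ℝ (Fin n) ↦ ‖penalizedLSE Θ f θ‖ + ‖z‖) 2
      (stdGaussian (EuclideanSpace ℝ (Fin n))) :=
    (memLp_const ‖penalizedLSE Θ f θ‖).add
      (IsGaussian.memLp_two_id (μ := stdGaussian (EuclideanSpace ℝ (Fin n)))).norm
  refine h1.mono' ?_ (Filter.Eventually.of_forall fun z ↦ ?_)
  · exact ((measurable_penalizedLSE hf).comp (measurable_const_add θ)).aestronglyMeasurable
  · have := (lipschitzWith_penalizedLSE hf).dist_le_mul (θ + z) θ
    rw [dist_eq_norm, dist_eq_norm, add_sub_cancel_left, NNReal.coe_one, one_mul] at this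
    have h3 := norm_le_norm_add_norm_sub' (penalizedLSE Θ f (θ + z)) (penalizedLSE Θ f θ)
    linarith

lemma integrable_penalizedLSE_sub_sq (hf : f ∈ penalties Θ) (θ b : EuclideanSpace ℝ (Fin n)) :
    Integrable (fun z ↦ ‖penalizedLSE Θ f (θ + z) - b‖ ^ 2)
      (stdGaussian (EuclideanSpace ℝ (Fin n))) :=
  ((memLp_penalizedLSE hf θ).sub (memLp_const b)).norm.integrable_sq

lemma risk_penalizedLSE_ne_top (hf : f ∈ penalties Θ) (θ : EuclideanSpace ℝ (Fin n)) :
    risk (penalizedLSE Θ f) θ ≠ ∞ := by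
  rw [risk_eq_lintegral (measurable_penalizedLSE hf)]
  exact (integrable_penalizedLSE_sub_sq hf θ θ).lintegral_lt_top.ne

lemma risk_penalizedLSE_eq_ofReal (hf : f ∈ penalties Θ) (θ : EuclideanSpace ℝ (Fin n)) :
    risk (penalizedLSE Θ f) θ = ENNReal.ofReal
      (∫ z, ‖penalizedLSE Θ f (θ + z) - θ‖ ^ 2 ∂stdGaussian (EuclideanSpace ℝ (Fin n))) := by
  rw [risk_eq_lintegral (measurable_penalizedLSE hf), ofReal_integral_eq_lintegral_ofReal
    (integrable_penalizedLSE_sub_sq hf θ θ) (Filter.Eventually.of_forall fun z ↦ by positivity)]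

lemma risk_penalizedLSE_le (hf : f ∈ penalties Θ) (θ w : EuclideanSpace ℝ (Fin n)) :
    risk (penalizedLSE Θ f) w ≤
      2 * risk (penalizedLSE Θ f) θ + ENNReal.ofReal (2 * ‖w - θ‖ ^ 2) := by
  have hm := measurable_penalizedLSE hf
  rw [risk_eq_lintegral hm, risk_eq_lintegral hm, ← lintegral_const_mul _ (by fun_prop)]
  calc _ ≤ ∫⁻ z, (2 * ENNReal.ofReal (‖penalizedLSE Θ f (θ + z) - θ‖ ^ 2) +
        ENNReal.ofReal (2 * ‖w - θ‖ ^ 2)) ∂stdGaussian (EuclideanSpace ℝ (Fin n)) := by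
        refine lintegral_mono fun z ↦ ?_
        have h2 : (2 : ℝ≥0∞) = ENNReal.ofReal 2 := (ENNReal.ofReal_ofNat 2).symm
        simp only [h2]
        rw [← ENNReal.ofReal_mul (by norm_num), ← ENNReal.ofReal_add (by positivity) (by positivity)]
        refine ENNReal.ofReal_le_ofReal ?_
        have h := norm_penalizedLSE_add_sub_le hf θ w z
        have h0 := norm_nonneg (penalizedLSE Θ f (w + z) - w)
        nlinarith [sq_nonneg (‖penalizedLSE Θ f (θ + z) - θ‖ - ‖w - θ‖)]
    _ = _ := by
        rw [lintegral_add_right _ measurable_const, lintegral_const, measure_univ, mul_one]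

end Prox

/-! ### A parameter with small bias -/

section Bias

variable {n : ℕ} {Θ : Set (EuclideanSpace ℝ (Fin n))} {f : EuclideanSpace ℝ (Fin n) → ℝ}

/-- The optimal value of the penalized least squares problem (the Moreau envelope of `f` on
`Θ`). -/
noncomputable def envelope (Θ : Set (EuclideanSpace ℝ (Fin n))) (f : EuclideanSpace ℝ (Fin n) → ℝ)
    (x : EuclideanSpace ℝ (Fin n)) : ℝ :=
  1 / 2 * ‖x - penalizedLSE Θ f x‖ ^ 2 + f (penalizedLSE Θ f x)

lemma envelope_le (hf : f ∈ penalties Θ) (x : EuclideanSpace ℝ (Fin n))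
    {α : EuclideanSpace ℝ (Fin n)} (hα : α ∈ Θ) :
    envelope Θ f x ≤ 1 / 2 * ‖x - α‖ ^ 2 + f α :=
  (isPenalizedMin_penalizedLSE hf x).2 hα

/-- The minimizer for `x` is a competitor for `y`. Thus `x - penalizedLSE Θ f x` plays the role of
the gradient of the envelope, with smoothness constant `1`. -/
lemma envelope_le_add (hf : f ∈ penalties Θ) (x y : EuclideanSpace ℝ (Fin n)) :
    envelope Θ f y ≤
      envelope Θ f x + (⟪x - penalizedLSE Θ f x, y - x⟫ + 1 / 2 * ‖y - x‖ ^ 2) := by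
  refine (envelope_le hf y (penalizedLSE_mem hf x)).trans_eq ?_
  have : y - penalizedLSE Θ f x = (x - penalizedLSE Θ f x) + (y - x) := by abel
  rw [this, norm_add_sq_real, envelope]
  ring

lemma continuous_envelope (hf : f ∈ penalties Θ) : Continuous (envelope Θ f) := by
  have hp := (lipschitzWith_penalizedLSE hf).continuous
  rw [continuous_iff_continuousAt]
  intro x
  have hlow : Continuous fun y ↦
      envelope Θ f x - (⟪y - penalizedLSE Θ f y, x - y⟫ + 1 / 2 * ‖x - y‖ ^ 2) := by fun_prop
  have hup : Continuous fun y ↦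
      envelope Θ f x + (⟪x - penalizedLSE Θ f x, y - x⟫ + 1 / 2 * ‖y - x‖ ^ 2) := by fun_prop
  refine tendsto_of_tendsto_of_tendsto_of_le_of_le (by simpa using hlow.tendsto x)
    (by simpa using hup.tendsto x) (fun y ↦ ?_) (fun y ↦ envelope_le_add hf x y)
  have := envelope_le_add hf y x
  dsimp only
  linarith

lemma integrable_envelope (hf : f ∈ penalties Θ) (hΘ : Θ.Nonempty)
    (θ : EuclideanSpace ℝ (Fin n)) :
    Integrable (fun z ↦ envelope Θ f (θ + z)) (stdGaussian (EuclideanSpace ℝ (Fin n))) := by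
  obtain ⟨α, hα⟩ := hΘ
  obtain ⟨B, hB⟩ := hf.2.1
  have hsq : Integrable (fun z ↦ ‖(θ - α) + z‖ ^ 2) (stdGaussian (EuclideanSpace ℝ (Fin n))) :=
    ((memLp_const (θ - α)).add (IsGaussian.memLp_two_id
      (μ := stdGaussian (EuclideanSpace ℝ (Fin n))))).norm.integrable_sq
  refine Integrable.mono' ((hsq.const_mul (1 / 2)).add (integrable_const (|f α| + |B|)))
    ((continuous_envelope hf).comp (continuous_const_add θ)).aestronglyMeasurable
    (Filter.Eventually.of_forall fun z ↦ ?_)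
  have h1 := envelope_le hf (θ + z) hα
  have h2 : B ≤ f (penalizedLSE Θ f (θ + z)) := hB ⟨_, penalizedLSE_mem hf _, rfl⟩
  have h3 : B ≤ envelope Θ f (θ + z) := by
    rw [envelope]; nlinarith [sq_nonneg ‖θ + z - penalizedLSE Θ f (θ + z)‖]
  have e : θ + z - α = (θ - α) + z := by abel
  rw [e] at h1
  rw [Pi.add_apply, Real.norm_eq_abs, abs_le]
  constructor
  · nlinarith [sq_nonneg ‖θ - α + z‖, neg_abs_le B, abs_nonneg (f α)]
  · linarith [le_abs_self (f α), abs_nonneg B]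

/-- The mean of the penalized least squares estimator. -/
noncomputable def meanLSE (Θ : Set (EuclideanSpace ℝ (Fin n))) (f : EuclideanSpace ℝ (Fin n) → ℝ)
    (θ : EuclideanSpace ℝ (Fin n)) : EuclideanSpace ℝ (Fin n) :=
  ∫ z, penalizedLSE Θ f (θ + z) ∂stdGaussian (EuclideanSpace ℝ (Fin n))

lemma integrable_penalizedLSE (hf : f ∈ penalties Θ) (θ : EuclideanSpace ℝ (Fin n)) :
    Integrable (fun z ↦ penalizedLSE Θ f (θ + z)) (stdGaussian (EuclideanSpace ℝ (Fin n))) :=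
  (memLp_penalizedLSE hf θ).integrable one_le_two

lemma meanLSE_mem (hΘ : Θ ∈ parameterSets n) (hf : f ∈ penalties Θ)
    (θ : EuclideanSpace ℝ (Fin n)) : meanLSE Θ f θ ∈ Θ :=
  hΘ.2.1.integral_mem hΘ.1 (Filter.Eventually.of_forall fun _ ↦ penalizedLSE_mem hf _)
    (integrable_penalizedLSE hf θ)

/-- Replacing `θ` by the mean of the estimator is a gradient step for the smoothed envelope. -/
lemma integral_envelope_meanLSE_le (hf : f ∈ penalties Θ) (hΘ : Θ.Nonempty)
    (θ : EuclideanSpace ℝ (Fin n)) :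
    ∫ z, envelope Θ f (meanLSE Θ f θ + z) ∂stdGaussian (EuclideanSpace ℝ (Fin n)) ≤
      ∫ z, envelope Θ f (θ + z) ∂stdGaussian (EuclideanSpace ℝ (Fin n)) -
        1 / 2 * ‖meanLSE Θ f θ - θ‖ ^ 2 := by
  set m := meanLSE Θ f θ with hm
  have hid : Integrable (fun z ↦ z) (stdGaussian (EuclideanSpace ℝ (Fin n))) :=
    IsGaussian.integrable_id
  have hadd : Integrable (fun z ↦ θ + z) (stdGaussian (EuclideanSpace ℝ (Fin n))) :=
    (integrable_const θ).add hid
  have hres : Integrable (fun z ↦ θ + z - penalizedLSE Θ f (θ + z))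
      (stdGaussian (EuclideanSpace ℝ (Fin n))) :=
    hadd.sub (integrable_penalizedLSE hf θ)
  have hin : ∫ z, ⟪θ + z - penalizedLSE Θ f (θ + z), m - θ⟫
      ∂stdGaussian (EuclideanSpace ℝ (Fin n)) = -‖m - θ‖ ^ 2 := by
    simp_rw [real_inner_comm (m - θ)]
    rw [integral_inner hres, integral_sub hadd
      (integrable_penalizedLSE hf θ), integral_add (integrable_const θ) hid,
      integral_id_stdGaussian]
    have : ∫ z, penalizedLSE Θ f (θ + z) ∂stdGaussian (EuclideanSpace ℝ (Fin n)) = m := rfl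
    rw [this, ← real_inner_self_eq_norm_sq, ← inner_neg_right]
    simp
  have hii : Integrable (fun z ↦ ⟪θ + z - penalizedLSE Θ f (θ + z), m - θ⟫)
      (stdGaussian (EuclideanSpace ℝ (Fin n))) := hres.inner_const _
  have hic : Integrable (fun z ↦ ⟪θ + z - penalizedLSE Θ f (θ + z), m - θ⟫ + 1 / 2 * ‖m - θ‖ ^ 2)
      (stdGaussian (EuclideanSpace ℝ (Fin n))) := hii.add (integrable_const _)
  calc _ ≤ ∫ z, (envelope Θ f (θ + z) + (⟪θ + z - penalizedLSE Θ f (θ + z), m - θ⟫ +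
        1 / 2 * ‖m - θ‖ ^ 2)) ∂stdGaussian (EuclideanSpace ℝ (Fin n)) := by
        refine integral_mono (integrable_envelope hf hΘ _)
          ((integrable_envelope hf hΘ _).add hic) fun z ↦ ?_
        have := envelope_le_add hf (θ + z) (m + z)
        rwa [show m + z - (θ + z) = m - θ by abel] at this
    _ = _ := by
        rw [integral_add (integrable_envelope hf hΘ _) hic,
          integral_add hii (integrable_const _), hin]
        simp
        ring

/-- Some parameter has small bias. -/
lemma exists_norm_meanLSE_sub_le_one (hΘ : Θ ∈ parameterSets n) (hf : f ∈ penalties Θ) :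
    ∃ θ ∈ Θ, ‖meanLSE Θ f θ - θ‖ ≤ 1 := by
  by_contra! hcon
  obtain ⟨θ₀, hθ₀⟩ := hΘ.2.2
  obtain ⟨B, hB⟩ := hf.2.1
  set V : EuclideanSpace ℝ (Fin n) → ℝ := fun θ ↦
    ∫ z, envelope Θ f (θ + z) ∂stdGaussian (EuclideanSpace ℝ (Fin n)) with hV
  -- If every bias exceeded `1`, each passage to the mean would lower `V` by at least `1 / 2` while
  -- staying in `Θ`, contradicting the lower bound on the penalty.
  have hiter (k : ℕ) : ∃ θ ∈ Θ, V θ ≤ V θ₀ - k / 2 := by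
    induction k with
    | zero => exact ⟨θ₀, hθ₀, by simp⟩
    | succ k ih =>
      obtain ⟨θ, hθ, hle⟩ := ih
      refine ⟨meanLSE Θ f θ, meanLSE_mem hΘ hf θ, ?_⟩
      have h1 := integral_envelope_meanLSE_le hf hΘ.2.2 θ
      have h2 := hcon θ hθ
      simp only [hV] at hle ⊢
      push_cast
      nlinarith
  have hlow (θ : EuclideanSpace ℝ (Fin n)) : B ≤ V θ := by
    have : ∫ _, B ∂stdGaussian (EuclideanSpace ℝ (Fin n)) ≤ V θ := by
      refine integral_mono (integrable_const B) (integrable_envelope hf hΘ.2.2 θ) fun z ↦ ?_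
      have h2 : B ≤ f (penalizedLSE Θ f (θ + z)) := hB ⟨_, penalizedLSE_mem hf _, rfl⟩
      dsimp only
      rw [envelope]; nlinarith [sq_nonneg ‖θ + z - penalizedLSE Θ f (θ + z)‖]
    simpa using this
  obtain ⟨k, hk⟩ := exists_nat_gt (2 * (V θ₀ - B))
  obtain ⟨θ, -, hle⟩ := hiter k
  linarith [hlow θ]

/-- Bias-variance decomposition: the second moment about any `b` is at least the variance, which is
the risk at `θ` minus the squared bias. This rules out concentration of the estimator near any point
`b`. -/
lemma integral_sub_sq_ge (hf : f ∈ penalties Θ) {θ : EuclideanSpace ℝ (Fin n)}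
    (hθ : ‖meanLSE Θ f θ - θ‖ ≤ 1) (b : EuclideanSpace ℝ (Fin n)) :
    ∫ z, ‖penalizedLSE Θ f (θ + z) - θ‖ ^ 2 ∂stdGaussian (EuclideanSpace ℝ (Fin n)) - 1 ≤
      ∫ z, ‖penalizedLSE Θ f (θ + z) - b‖ ^ 2 ∂stdGaussian (EuclideanSpace ℝ (Fin n)) := by
  have hi : Integrable (fun z ↦ ⟪b - θ, penalizedLSE Θ f (θ + z)⟫)
      (stdGaussian (EuclideanSpace ℝ (Fin n))) := (integrable_penalizedLSE hf θ).const_inner _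
  have hic : Integrable (fun z ↦ (‖b‖ ^ 2 - ‖θ‖ ^ 2) - 2 * ⟪b - θ, penalizedLSE Θ f (θ + z)⟫)
      (stdGaussian (EuclideanSpace ℝ (Fin n))) := (integrable_const _).sub (hi.const_mul 2)
  have h1 (z : EuclideanSpace ℝ (Fin n)) : ‖penalizedLSE Θ f (θ + z) - b‖ ^ 2 =
      ‖penalizedLSE Θ f (θ + z) - θ‖ ^ 2 + ((‖b‖ ^ 2 - ‖θ‖ ^ 2) -
        2 * ⟪b - θ, penalizedLSE Θ f (θ + z)⟫) := by
    rw [norm_sub_sq_real, norm_sub_sq_real, inner_sub_left, real_inner_comm b, real_inner_comm θ]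
    ring
  simp_rw [h1]
  rw [integral_add (integrable_penalizedLSE_sub_sq hf θ θ) hic, integral_sub (integrable_const _)
    (hi.const_mul 2), integral_const_mul, integral_inner (integrable_penalizedLSE hf θ)]
  change _ ≤ _ + (_ - 2 * ⟪b - θ, meanLSE Θ f θ⟫)
  set m := meanLSE Θ f θ
  have h2 : ‖b‖ ^ 2 - ‖θ‖ ^ 2 - 2 * ⟪b - θ, m⟫ = ‖m - b‖ ^ 2 - ‖m - θ‖ ^ 2 := by
    rw [norm_sub_sq_real, norm_sub_sq_real, inner_sub_left, real_inner_comm b, real_inner_comm θ]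
    ring
  simp only [integral_const, probReal_univ, one_smul]
  rw [h2]
  nlinarith [sq_nonneg ‖m - b‖, norm_nonneg (m - θ)]

end Bias

/-! ### Change-of-measure bounds for arbitrary estimators -/

section TestingBounds

variable {n : ℕ} {δ : EuclideanSpace ℝ (Fin n) → EuclideanSpace ℝ (Fin n)}

/-- The risk at `θ₁` as an integral against the Gaussian centred at `θ₀`. -/
lemma risk_eq_lintegral_likelihood (hδ : Measurable δ) (θ₀ θ₁ : EuclideanSpace ℝ (Fin n)) :
    risk δ θ₁ = ∫⁻ z, ENNReal.ofReal (likelihood (θ₁ - θ₀) z * ‖δ (θ₀ + z) - θ₁‖ ^ 2)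
      ∂stdGaussian (EuclideanSpace ℝ (Fin n)) := by
  rw [risk_eq_lintegral hδ]
  have := lintegral_stdGaussian_add (θ₁ - θ₀)
    (g := fun y ↦ ENNReal.ofReal (‖δ (θ₀ + y) - θ₁‖ ^ 2)) (by fun_prop)
  simp_rw [ENNReal.ofReal_mul (likelihood_pos _ _).le]
  rw [← this]
  refine lintegral_congr fun z ↦ ?_
  rw [show θ₀ + (θ₁ - θ₀ + z) = θ₁ + z by abel]

/-- Two-point lower bound. -/
lemma ofReal_le_risk_add_risk (hδ : Measurable δ) {θ₀ θ₁ : EuclideanSpace ℝ (Fin n)}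
    (h : ‖θ₁ - θ₀‖ ≤ 1) :
    ENNReal.ofReal (‖θ₁ - θ₀‖ ^ 2 / 4) ≤ risk δ θ₀ + risk δ θ₁ := by
  rw [risk_eq_lintegral_likelihood hδ θ₀ θ₁, risk_eq_lintegral hδ,
    ← lintegral_add_left (by fun_prop)]
  set d := ‖θ₁ - θ₀‖ with hd
  have hpt (z : EuclideanSpace ℝ (Fin n)) :
      7 / 16 * d ^ 2 * likelihood (θ₁ - θ₀) z ≤
      (‖δ (θ₀ + z) - θ₀‖ ^ 2 + likelihood (θ₁ - θ₀) z * ‖δ (θ₀ + z) - θ₁‖ ^ 2) +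
        d ^ 2 / 16 * likelihood (θ₁ - θ₀) z ^ 2 := by
    have hL := likelihood_pos (θ₁ - θ₀) z
    set L := likelihood (θ₁ - θ₀) z
    set a := ‖δ (θ₀ + z) - θ₀‖
    set b := ‖δ (θ₀ + z) - θ₁‖
    have htri : d ≤ a + b := by
      rw [hd, show θ₁ - θ₀ = (δ (θ₀ + z) - θ₀) - (δ (θ₀ + z) - θ₁) by abel]
      exact norm_sub_le _ _
    have hd0 : 0 ≤ d := norm_nonneg _
    have h1 : d ^ 2 ≤ (a + b) ^ 2 := by gcongr
    have h2 : L * d ^ 2 ≤ (1 + L) * (a ^ 2 + L * b ^ 2) := by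
      nlinarith [sq_nonneg (a - L * b), mul_le_mul_of_nonneg_left h1 hL.le]
    -- `(7 - L) / 16` is the tangent to the convex function `1 / (1 + L)` at `L = 3`, the value
    -- later used to bound `exp (d ^ 2)`; it leaves `7 / 16 - 3 / 16 = 1 / 4`.
    have h3 : (1 + L) * (7 / 16 * d ^ 2 * L - d ^ 2 / 16 * L ^ 2) ≤ L * d ^ 2 := by
      have : L * d ^ 2 - (1 + L) * (7 / 16 * d ^ 2 * L - d ^ 2 / 16 * L ^ 2) =
        L * d ^ 2 * (L - 3) ^ 2 / 16 := by ring
      have : 0 ≤ L * d ^ 2 * (L - 3) ^ 2 / 16 := by positivity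
      linarith
    have h4 := le_of_mul_le_mul_left (h3.trans h2) (by linarith)
    linarith
  have hbound : ENNReal.ofReal (7 / 16 * d ^ 2) ≤
      ∫⁻ z, (ENNReal.ofReal (‖δ (θ₀ + z) - θ₀‖ ^ 2) +
        ENNReal.ofReal (likelihood (θ₁ - θ₀) z * ‖δ (θ₀ + z) - θ₁‖ ^ 2))
        ∂stdGaussian (EuclideanSpace ℝ (Fin n)) +
      ENNReal.ofReal (d ^ 2 / 16 * exp (d ^ 2)) := by
    calc ENNReal.ofReal (7 / 16 * d ^ 2) =
        ∫⁻ z, ENNReal.ofReal (7 / 16 * d ^ 2 * likelihood (θ₁ - θ₀) z)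
          ∂stdGaussian (EuclideanSpace ℝ (Fin n)) := by
          simp_rw [ENNReal.ofReal_mul (show 0 ≤ 7 / 16 * d ^ 2 by positivity)]
          rw [lintegral_const_mul _ (by fun_prop), lintegral_likelihood, mul_one]
      _ ≤ ∫⁻ z, ((ENNReal.ofReal (‖δ (θ₀ + z) - θ₀‖ ^ 2) +
        ENNReal.ofReal (likelihood (θ₁ - θ₀) z * ‖δ (θ₀ + z) - θ₁‖ ^ 2)) +
          ENNReal.ofReal (d ^ 2 / 16 * likelihood (θ₁ - θ₀) z ^ 2))
          ∂stdGaussian (EuclideanSpace ℝ (Fin n)) := by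
          refine lintegral_mono fun z ↦ ?_
          have hL := likelihood_pos (θ₁ - θ₀) z
          rw [← ENNReal.ofReal_add (by positivity) (by positivity),
            ← ENNReal.ofReal_add (by positivity) (by positivity)]
          exact ENNReal.ofReal_le_ofReal (hpt z)
      _ = _ := by
          rw [lintegral_add_right _ (by fun_prop)]
          simp_rw [ENNReal.ofReal_mul (show 0 ≤ d ^ 2 / 16 by positivity)]
          rw [lintegral_const_mul _ (by fun_prop), lintegral_likelihood_sq]
  refine (ENNReal.add_le_add_iff_right (ENNReal.ofReal_ne_top
    (r := d ^ 2 / 16 * exp (d ^ 2)))).1 (le_trans ?_ hbound)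
  rw [← ENNReal.ofReal_add (by positivity) (by positivity)]
  refine ENNReal.ofReal_le_ofReal ?_
  have hexp : exp (d ^ 2) ≤ 3 := by
    refine (exp_le_exp.2 (pow_le_one₀ (norm_nonneg _) h)).trans ?_
    linarith [exp_one_lt_d9]
  nlinarith [sq_nonneg d, mul_le_mul_of_nonneg_left hexp (sq_nonneg d)]

/-- If `δ` has small risk at `w`, then under `N(θ₀, I)` it is close to `w` with probability
not much smaller than `exp (-‖w - θ₀‖²)`. -/
lemma ofReal_exp_le_measure (hδ : Measurable δ) {θ₀ w : EuclideanSpace ℝ (Fin n)} {s : ℝ}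
    (hs : 0 < s) (hw : risk δ w ≤ ENNReal.ofReal (s ^ 2 / 4)) :
    ENNReal.ofReal (1 / 2 * exp (-‖w - θ₀‖ ^ 2)) ≤
      stdGaussian (EuclideanSpace ℝ (Fin n)) {z | ‖δ (θ₀ + z) - w‖ ≤ s} := by
  set γ := stdGaussian (EuclideanSpace ℝ (Fin n)) with hγ
  set d := ‖w - θ₀‖ with hd
  set S : Set (EuclideanSpace ℝ (Fin n)) := {z | ‖δ (θ₀ + z) - w‖ ≤ s} with hS
  have hSm : MeasurableSet S := measurableSet_le (by fun_prop) measurable_const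
  set S₁ : Set (EuclideanSpace ℝ (Fin n)) := {z | ‖δ (w + z) - w‖ ≤ s} with hS₁
  have hSm₁ : MeasurableSet S₁ := measurableSet_le (by fun_prop) measurable_const
  have hc : γ S₁ᶜ ≤ ENNReal.ofReal (1 / 4) := by
    rw [risk_eq_lintegral hδ] at hw
    have hmk := mul_meas_ge_le_lintegral (μ := γ)
      (f := fun z ↦ ENNReal.ofReal (‖δ (w + z) - w‖ ^ 2)) (by fun_prop) (ENNReal.ofReal (s ^ 2))
    have hsub : S₁ᶜ ⊆ {z | ENNReal.ofReal (s ^ 2) ≤ ENNReal.ofReal (‖δ (w + z) - w‖ ^ 2)} := by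
      intro z hz
      simp only [hS₁, Set.mem_compl_iff, Set.mem_ofPred_eq, not_le] at hz ⊢
      exact ENNReal.ofReal_le_ofReal (by gcongr)
    have h1 : ENNReal.ofReal (s ^ 2) * γ S₁ᶜ ≤
        ENNReal.ofReal (s ^ 2) * ENNReal.ofReal (1 / 4) := by
      rw [← ENNReal.ofReal_mul (by positivity)]
      refine (mul_le_mul_right (measure_mono hsub) _).trans (hmk.trans (hw.trans_eq ?_))
      congr 1; ring
    exact (ENNReal.mul_le_mul_iff_right (by simpa using hs.ne') ENNReal.ofReal_ne_top).1 h1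
  have h34 : ENNReal.ofReal (3 / 4) ≤ γ S₁ := by
    have h1 : ENNReal.ofReal (3 / 4) + ENNReal.ofReal (1 / 4) ≤ γ S₁ + ENNReal.ofReal (1 / 4) := by
      rw [← ENNReal.ofReal_add (by norm_num) (by norm_num)]
      calc ENNReal.ofReal (3 / 4 + 1 / 4) = γ S₁ + γ S₁ᶜ := by
            rw [measure_add_measure_compl hSm₁, hγ, measure_univ]; norm_num
        _ ≤ _ := by gcongr
    exact (ENNReal.add_le_add_iff_right ENNReal.ofReal_ne_top).1 h1
  have hshift : γ S₁ = ∫⁻ z, ENNReal.ofReal (likelihood (w - θ₀) z) * S.indicator 1 z ∂γ := by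
    rw [← lintegral_stdGaussian_add (w - θ₀) (measurable_one.indicator hSm),
      ← lintegral_indicator_one hSm₁]
    refine lintegral_congr fun z ↦ ?_
    simp only [Set.indicator, hS, hS₁, Set.mem_ofPred_eq]
    rw [show θ₀ + (w - θ₀ + z) = w + z by abel]
    rfl
  -- AM-GM: on `S`, `L ≤ exp (-d ^ 2) * L ^ 2 / 2 + exp (d ^ 2) / 2`. The weights make the first
  -- term integrate to exactly `1 / 2`, below the available `3 / 4`.
  have hup : γ S₁ ≤ ENNReal.ofReal (1 / 2) + ENNReal.ofReal (1 / 2 * exp (d ^ 2)) * γ S := by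
    rw [hshift]
    calc _ ≤ ∫⁻ z, (ENNReal.ofReal (1 / 2 * exp (-d ^ 2)) *
          ENNReal.ofReal (likelihood (w - θ₀) z ^ 2) +
          ENNReal.ofReal (1 / 2 * exp (d ^ 2)) * S.indicator 1 z) ∂γ := by
          refine lintegral_mono fun z ↦ ?_
          by_cases hz : z ∈ S
          · have hL := likelihood_pos (w - θ₀) z
            set L := likelihood (w - θ₀) z
            simp only [Set.indicator_of_mem hz, Pi.one_apply, mul_one]
            rw [← ENNReal.ofReal_mul (by positivity), ← ENNReal.ofReal_add (by positivity)
              (by positivity)]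
            refine ENNReal.ofReal_le_ofReal ?_
            have he : exp (-d ^ 2) * exp (d ^ 2) = 1 := by rw [← exp_add]; simp
            have h5 : exp (d ^ 2) * (exp (-d ^ 2) * L - 1) ^ 2 =
                exp (-d ^ 2) * L ^ 2 - 2 * L + exp (d ^ 2) := by
              linear_combination (exp (-d ^ 2) * L ^ 2 - 2 * L) * he
            nlinarith [mul_nonneg (exp_pos (d ^ 2)).le (sq_nonneg (exp (-d ^ 2) * L - 1))]
          · simp [Set.indicator_of_notMem hz]
      _ = _ := by
          rw [lintegral_add_right _ ((measurable_one.indicator hSm).const_mul _),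
            lintegral_const_mul _ (by fun_prop), lintegral_const_mul _
              (measurable_one.indicator hSm), lintegral_indicator_one hSm, hγ,
            lintegral_likelihood_sq, ← ENNReal.ofReal_mul (by positivity), mul_assoc, ← exp_add, ← hd]
          simp
  have h6 : ENNReal.ofReal (1 / 4) ≤ ENNReal.ofReal (1 / 2 * exp (d ^ 2)) * γ S := by
    refine (ENNReal.add_le_add_iff_left (ENNReal.ofReal_ne_top (r := 1 / 2))).1
      (le_trans ?_ (h34.trans hup))
    rw [← ENNReal.ofReal_add (by norm_num) (by norm_num)]
    norm_num
  refine (ENNReal.mul_le_mul_iff_right (a := ENNReal.ofReal (1 / 2 * exp (d ^ 2)))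
    (by simp [exp_pos]) ENNReal.ofReal_ne_top).1 (le_trans (le_of_eq ?_) h6)
  rw [← ENNReal.ofReal_mul (by positivity)]
  have he : exp (d ^ 2) * exp (-d ^ 2) = 1 := by rw [← exp_add]; simp
  congr 1
  linear_combination (1 / 4) * he

end TestingBounds

/-! ### The lower bound on the normalized minimax risk -/

section LowerBound

variable {n : ℕ} {Θ : Set (EuclideanSpace ℝ (Fin n))} {f : EuclideanSpace ℝ (Fin n) → ℝ}
  {δ : EuclideanSpace ℝ (Fin n) → EuclideanSpace ℝ (Fin n)}

/-- Where the risk of the penalized least squares estimator is positive and bounded, comparing two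
nearby parameters shows that no estimator improves on it by a large factor. -/
lemma exists_lt_risk_of_le (hΘ : Θ ∈ parameterSets n) (hf : f ∈ penalties Θ) (hδ : Measurable δ)
    {κ : ℝ} (hκ0 : 0 ≤ κ) (hκ : κ ≤ 0.00000605) {θ₀ : EuclideanSpace ℝ (Fin n)} (hθ₀ : θ₀ ∈ Θ)
    {r : ℝ} (hr0 : 0 < r) (hr : r ≤ 85)
    (hrisk : ∫ z, ‖penalizedLSE Θ f (θ₀ + z) - θ₀‖ ^ 2
      ∂stdGaussian (EuclideanSpace ℝ (Fin n)) = r ^ 2) :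
    ∃ θ ∈ Θ, ENNReal.ofReal (κ) * risk (penalizedLSE Θ f) θ < risk δ θ := by
  by_contra! hall
  obtain ⟨z, hz⟩ := exists_integral_le (integrable_penalizedLSE_sub_sq hf θ₀ θ₀)
  rw [hrisk] at hz
  have hα := penalizedLSE_mem hf (θ₀ + z)
  set α := penalizedLSE Θ f (θ₀ + z)
  have hrα : r ≤ ‖α - θ₀‖ := le_of_sq_le_sq hz (norm_nonneg _)
  have hα0 : 0 < ‖α - θ₀‖ := hr0.trans_le hrα
  -- The cap at `1` is for the two-point bound; the cap at `r` keeps `θ₁` on the segment from `θ₀`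
  -- to `α`.
  set d := min 1 r with hd
  have hd0 : 0 < d := lt_min one_pos hr0
  have hdα : d ≤ ‖α - θ₀‖ := (min_le_right _ _).trans hrα
  set θ₁ := θ₀ + (d / ‖α - θ₀‖) • (α - θ₀) with hθ₁
  have hmem : θ₁ ∈ Θ := hΘ.2.1.add_smul_sub_mem hθ₀ hα
    ⟨by positivity, by rw [div_le_one hα0]; exact hdα⟩
  have hnorm : ‖θ₁ - θ₀‖ = d := by
    rw [hθ₁, add_sub_cancel_left, norm_smul, norm_div, norm_norm, Real.norm_of_nonneg hd0.le,
      div_mul_cancel₀ _ hα0.ne']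
  have h0 : risk (penalizedLSE Θ f) θ₀ = ENNReal.ofReal (r ^ 2) := by
    rw [risk_penalizedLSE_eq_ofReal hf, hrisk]
  have h1 : risk (penalizedLSE Θ f) θ₁ ≤ ENNReal.ofReal (2 * r ^ 2 + 2 * d ^ 2) := by
    refine (risk_penalizedLSE_le hf θ₀ θ₁).trans_eq ?_
    rw [h0, hnorm, ENNReal.ofReal_add (by positivity) (by positivity),
      ENNReal.ofReal_mul (show (0 : ℝ) ≤ 2 by norm_num) (q := r ^ 2), ENNReal.ofReal_ofNat]
  have h2 := ofReal_le_risk_add_risk hδ (θ₀ := θ₀) (θ₁ := θ₁)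
    (by rw [hnorm]; exact min_le_left _ _)
  rw [hnorm] at h2
  have h3 : ENNReal.ofReal (d ^ 2 / 4) ≤ ENNReal.ofReal (κ * r ^ 2 +
      κ * (2 * r ^ 2 + 2 * d ^ 2)) := by
    rw [ENNReal.ofReal_add (by positivity) (by positivity),
      ENNReal.ofReal_mul (by positivity), ENNReal.ofReal_mul (by positivity)]
    refine h2.trans (add_le_add ((hall θ₀ hθ₀).trans_eq (by rw [h0])) ((hall θ₁ hmem).trans ?_))
    exact mul_le_mul_right h1 _
  rw [ENNReal.ofReal_le_ofReal_iff (by positivity)] at h3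
  -- The two cases reduce to `1 / 4 ≤ κ (3 r ^ 2 + 2)` with `r ≤ 85`, and `1 / 4 ≤ 5 κ`; both fail.
  rcases min_cases 1 r with ⟨h, _⟩ | ⟨h, _⟩
  · rw [hd, h] at h3
    nlinarith [mul_le_mul_of_nonneg_right hκ (show 0 ≤ 3 * r ^ 2 + 2 by positivity)]
  · rw [hd, h] at h3
    nlinarith [pow_pos hr0 2, mul_le_mul_of_nonneg_right hκ (sq_nonneg r)]

/-- Where the risk of the penalized least squares estimator is large and its bias is small, the
shrunken law of the estimator itself is a prior that is hard for every estimator. -/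
lemma exists_lt_risk_of_ge (hΘ : Θ ∈ parameterSets n) (hf : f ∈ penalties Θ) (hδ : Measurable δ)
    {κ : ℝ} (hκ0 : 0 ≤ κ) (hκ : κ ≤ 0.00000605) {θ₀ : EuclideanSpace ℝ (Fin n)} (hθ₀ : θ₀ ∈ Θ)
    (hbias : ‖meanLSE Θ f θ₀ - θ₀‖ ≤ 1) {r : ℝ} (hr : 85 ≤ r)
    (hrisk : ∫ z, ‖penalizedLSE Θ f (θ₀ + z) - θ₀‖ ^ 2
      ∂stdGaussian (EuclideanSpace ℝ (Fin n)) = r ^ 2) :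
    ∃ θ ∈ Θ, ENNReal.ofReal (κ) * risk (penalizedLSE Θ f) θ < risk δ θ := by
  by_contra! hall
  have hr0 : 0 < r := by linarith
  set γ := stdGaussian (EuclideanSpace ℝ (Fin n)) with hγ
  have hpm := measurable_penalizedLSE hf
  set T : EuclideanSpace ℝ (Fin n) → EuclideanSpace ℝ (Fin n) :=
    fun y ↦ penalizedLSE Θ f (θ₀ + y) with hT
  have hTm : Measurable T := hpm.comp (measurable_const_add θ₀)
  have hTlip : LipschitzWith 1 T := by
    simpa [hT, Function.comp_def] using
      (lipschitzWith_penalizedLSE hf).comp (isometry_add_left θ₀).lipschitz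
  -- The contraction `1 / 20` keeps typical prior points within `r / 10` of `θ₀`, making the
  -- change-of-measure cost `exp (-0.01 r ^ 2)` weaker than the concentration rate `0.032 r ^ 2`.
  set W : EuclideanSpace ℝ (Fin n) → EuclideanSpace ℝ (Fin n) :=
    fun y ↦ θ₀ + (1 / 20 : ℝ) • (T y - θ₀) with hW
  have hWm : Measurable W := by fun_prop
  have h0 : risk (penalizedLSE Θ f) θ₀ = ENNReal.ofReal (r ^ 2) := by
    rw [risk_penalizedLSE_eq_ofReal hf, hrisk]
  set G : Set (EuclideanSpace ℝ (Fin n)) := {y | ‖T y - θ₀‖ ≤ 2 * r} with hG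
  have hGm : MeasurableSet G := measurableSet_le (by fun_prop) measurable_const
  have hGc : γ Gᶜ ≤ ENNReal.ofReal (1 / 4) := by
    have hmk := mul_meas_ge_le_lintegral (μ := γ)
      (f := fun z ↦ ENNReal.ofReal (‖T z - θ₀‖ ^ 2)) (by fun_prop) (ENNReal.ofReal ((2 * r) ^ 2))
    have hsub : Gᶜ ⊆ {z | ENNReal.ofReal ((2 * r) ^ 2) ≤ ENNReal.ofReal (‖T z - θ₀‖ ^ 2)} := by
      intro z hz
      simp only [hG, Set.mem_compl_iff, Set.mem_ofPred_eq, not_le] at hz ⊢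
      exact ENNReal.ofReal_le_ofReal (by gcongr)
    have h1 : ENNReal.ofReal ((2 * r) ^ 2) * γ Gᶜ ≤
        ENNReal.ofReal ((2 * r) ^ 2) * ENNReal.ofReal (1 / 4) := by
      rw [← ENNReal.ofReal_mul (by positivity)]
      refine (mul_le_mul_right (measure_mono hsub) _).trans (hmk.trans_eq ?_)
      rw [← risk_eq_lintegral hpm, h0]
      congr 1; ring
    exact (ENNReal.mul_le_mul_iff_right (by simpa using hr0.ne') ENNReal.ofReal_ne_top).1 h1
  have hG34 : ENNReal.ofReal (3 / 4) ≤ γ G := by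
    have h1 : ENNReal.ofReal (3 / 4) + ENNReal.ofReal (1 / 4) ≤ γ G + ENNReal.ofReal (1 / 4) := by
      rw [← ENNReal.ofReal_add (by norm_num) (by norm_num)]
      calc ENNReal.ofReal (3 / 4 + 1 / 4) = γ G + γ Gᶜ := by
            rw [measure_add_measure_compl hGm, hγ, measure_univ]; norm_num
        _ ≤ _ := by gcongr
    exact (ENNReal.add_le_add_iff_right ENNReal.ofReal_ne_top).1 h1
  have hpoint (y) (hy : y ∈ G) : ENNReal.ofReal (1 / 2 * exp (-(0.01 * r ^ 2))) ≤
      γ {z | ‖δ (θ₀ + z) - W y‖ ≤ r / 40} := by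
    have hyn : ‖T y - θ₀‖ ≤ 2 * r := hy
    have hWmem : W y ∈ Θ := hΘ.2.1.add_smul_sub_mem hθ₀ (penalizedLSE_mem hf _)
      ⟨by norm_num, by norm_num⟩
    have hWn : ‖W y - θ₀‖ ≤ r / 10 := by
      rw [hW]
      simp only [add_sub_cancel_left, norm_smul]
      norm_num
      linarith
    have hWsq : ‖W y - θ₀‖ ^ 2 ≤ (r / 10) ^ 2 := by gcongr
    have hδW : risk δ (W y) ≤ ENNReal.ofReal ((r / 40) ^ 2 / 4) := by
      refine (hall _ hWmem).trans ?_
      calc _ ≤ ENNReal.ofReal (κ) *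
            (2 * ENNReal.ofReal (r ^ 2) + ENNReal.ofReal (2 * ‖W y - θ₀‖ ^ 2)) := by
            gcongr
            rw [← h0]
            exact risk_penalizedLSE_le hf θ₀ (W y)
        _ = ENNReal.ofReal (κ * (2 * r ^ 2 + 2 * ‖W y - θ₀‖ ^ 2)) := by
            rw [ENNReal.ofReal_mul hκ0, ENNReal.ofReal_add (by positivity)
              (by positivity), ENNReal.ofReal_mul (show (0 : ℝ) ≤ 2 by norm_num) (q := r ^ 2),
              ENNReal.ofReal_ofNat]
        _ ≤ _ := by
            refine ENNReal.ofReal_le_ofReal ?_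
            nlinarith [mul_le_mul_of_nonneg_right hκ
              (show 0 ≤ 2 * r ^ 2 + 2 * ‖W y - θ₀‖ ^ 2 by positivity)]
    refine le_trans (ENNReal.ofReal_le_ofReal ?_) (ofReal_exp_le_measure hδ (by positivity) hδW)
    gcongr
    nlinarith
  have hball (z) : γ {y | ‖δ (θ₀ + z) - W y‖ ≤ r / 40} ≤
      2 * ENNReal.ofReal (exp (-(0.032 * r ^ 2))) := by
    -- Undoing the contraction turns the ball of radius `r / 40` for `W` into the ball of radius `r
    -- / 2` about `b` for `T`.
    set b := θ₀ + (20 : ℝ) • (δ (θ₀ + z) - θ₀) with hb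
    have hF : LipschitzWith 1 (fun y ↦ ‖T y - b‖) := by
      simpa [dist_eq_norm, Function.comp_def] using (LipschitzWith.dist_left b).comp hTlip
    have h2 : ENNReal.ofReal (r ^ 2 - 1) ≤ ∫⁻ y, ENNReal.ofReal (‖T y - b‖ ^ 2) ∂γ := by
      rw [← ofReal_integral_eq_lintegral_ofReal (integrable_penalizedLSE_sub_sq hf θ₀ b)
        (Filter.Eventually.of_forall fun y ↦ by positivity), ← hrisk]
      exact ENNReal.ofReal_le_ofReal (integral_sub_sq_ge hf hbias b)
    refine le_trans (measure_mono fun y hy ↦ ?_)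
      (measure_le_half_le hF (fun y ↦ norm_nonneg _) hr h2)
    simp only [Set.mem_ofPred_eq] at hy ⊢
    have e : δ (θ₀ + z) - W y = (1 / 20 : ℝ) • (b - T y) := by
      rw [hW, hb]; module
    rw [e, norm_smul, norm_sub_rev] at hy
    norm_num at hy
    linarith
  have hSm : MeasurableSet {q : EuclideanSpace ℝ (Fin n) × EuclideanSpace ℝ (Fin n) |
      ‖δ (θ₀ + q.2) - W q.1‖ ≤ r / 40} := measurableSet_le (by fun_prop) measurable_const
  -- Both sides bound the probability, over independent `y` and `z`, that `δ (θ₀ + z)` is within `r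
  -- / 40` of `W y`: from below by fixing `y`, from above by fixing `z`.
  have hfin : ENNReal.ofReal (1 / 2 * exp (-(0.01 * r ^ 2)) * (3 / 4)) ≤
      ENNReal.ofReal (2 * exp (-(0.032 * r ^ 2))) := by
    calc _ ≤ ENNReal.ofReal (1 / 2 * exp (-(0.01 * r ^ 2))) * γ G := by
          rw [ENNReal.ofReal_mul (by positivity)]; gcongr
      _ = ∫⁻ _ in G, ENNReal.ofReal (1 / 2 * exp (-(0.01 * r ^ 2))) ∂γ := by
          rw [setLIntegral_const]
      _ ≤ ∫⁻ y in G, γ {z | ‖δ (θ₀ + z) - W y‖ ≤ r / 40} ∂γ := setLIntegral_mono' hGm hpoint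
      _ ≤ ∫⁻ y, γ {z | ‖δ (θ₀ + z) - W y‖ ≤ r / 40} ∂γ := setLIntegral_le_lintegral _ _
      _ = (γ.prod γ) {q | ‖δ (θ₀ + q.2) - W q.1‖ ≤ r / 40} := by
          rw [Measure.prod_apply hSm]; rfl
      _ = ∫⁻ z, γ {y | ‖δ (θ₀ + z) - W y‖ ≤ r / 40} ∂γ := by
          rw [Measure.prod_apply_symm hSm]; rfl
      _ ≤ ∫⁻ _, 2 * ENNReal.ofReal (exp (-(0.032 * r ^ 2))) ∂γ := lintegral_mono hball
      _ = _ := by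
          rw [lintegral_const, hγ, measure_univ, mul_one,
            ENNReal.ofReal_mul (by norm_num), ENNReal.ofReal_ofNat]
  rw [ENNReal.ofReal_le_ofReal_iff (by positivity)] at hfin
  have he : exp (-(0.01 * r ^ 2)) = exp (0.022 * r ^ 2) * exp (-(0.032 * r ^ 2)) := by
    rw [← exp_add]; ring_nf
  have h22 : 0.022 * r ^ 2 + 1 ≤ exp (0.022 * r ^ 2) := add_one_le_exp _
  rw [he] at hfin
  have h100 : 100 ≤ exp (0.022 * r ^ 2) := by nlinarith
  nlinarith [exp_pos (-(0.032 * r ^ 2)),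
    mul_le_mul_of_nonneg_right h100 (exp_pos (-(0.032 * r ^ 2))).le]

/-- No estimator improves on penalized least squares by a large factor everywhere on `Θ`. -/
theorem le_normalizedMinimaxRisk (hΘ : Θ ∈ parameterSets n) (hf : f ∈ penalties Θ) :
    ENNReal.ofReal (6.05 * 10 ^ (-6 : ℤ)) ≤ normalizedMinimaxRisk Θ f := by
  refine le_iInf₂ fun δ hδ ↦ ?_
  obtain ⟨θ₀, hθ₀, hbias⟩ := exists_norm_meanLSE_sub_le_one hΘ hf
  set κ := ENNReal.ofReal (6.05 * 10 ^ (-6 : ℤ)) with hκ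
  have hκ1 : κ ≤ 1 := by rw [hκ, ENNReal.ofReal_le_one]; norm_num
  by_cases hzero : risk (penalizedLSE Θ f) θ₀ = 0
  · refine le_iSup₂_of_le θ₀ hθ₀ ?_
    rw [hzero, riskRatio]
    split_ifs with h
    · exact hκ1
    · rw [ENNReal.div_zero (by simpa using h)]; exact le_top
  set R := ∫ z, ‖penalizedLSE Θ f (θ₀ + z) - θ₀‖ ^ 2
      ∂stdGaussian (EuclideanSpace ℝ (Fin n)) with hR
  have hR0 : 0 < R := by
    rw [risk_penalizedLSE_eq_ofReal hf, ENNReal.ofReal_eq_zero, not_le] at hzero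
    exact hzero
  have hsq : R = √R ^ 2 := (sq_sqrt hR0.le).symm
  obtain ⟨θ, hθ, hlt⟩ : ∃ θ ∈ Θ, κ * risk (penalizedLSE Θ f) θ < risk δ θ := by
    rcases le_total √R 85 with h | h
    · exact exists_lt_risk_of_le hΘ hf hδ (by norm_num) (by norm_num) hθ₀ (sqrt_pos.2 hR0) h hsq
    · exact exists_lt_risk_of_ge hΘ hf hδ (by norm_num) (by norm_num) hθ₀ hbias h hsq
  refine le_iSup₂_of_le θ hθ ?_
  have hpos : risk δ θ ≠ 0 := (pos_of_gt hlt).ne'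
  rw [riskRatio, if_neg (by tauto)]
  exact (ENNReal.le_div_iff_mul_le (Or.inr hpos)
    (Or.inl (risk_penalizedLSE_ne_top hf θ))).2 hlt.le

end LowerBound

/-! ### The upper bound from short intervals -/

section UpperBound

lemma norm_eq_abs_apply_zero (x : EuclideanSpace ℝ (Fin 1)) : ‖x‖ = |x 0| := by
  rw [EuclideanSpace.norm_eq]
  simp [sqrt_sq_eq_abs]

lemma closedBall_mem_parameterSets {n : ℕ} {a : ℝ} (ha : 0 ≤ a) :
    Metric.closedBall (0 : EuclideanSpace ℝ (Fin n)) a ∈ parameterSets n :=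
  ⟨Metric.isClosed_closedBall, convex_closedBall 0 a, Metric.nonempty_closedBall.2 ha⟩

lemma zero_mem_penalties_closedBall {n : ℕ} {a : ℝ} (ha : 0 ≤ a) :
    (fun _ ↦ 0) ∈ penalties (Metric.closedBall (0 : EuclideanSpace ℝ (Fin n)) a) := by
  refine ⟨convexOn_const 0 (convex_closedBall 0 a), ⟨0, ?_⟩, fun x ↦ ?_⟩
  · rintro _ ⟨y, -, rfl⟩
    exact le_rfl
  · obtain ⟨b, hb, hmin⟩ := (isCompact_closedBall (0 : EuclideanSpace ℝ (Fin n)) a).exists_isMinOn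
      (Metric.nonempty_closedBall.2 ha)
      (f := fun α ↦ 1 / 2 * ‖x - α‖ ^ 2 + (fun _ ↦ (0 : ℝ)) α) (by fun_prop)
    exact ⟨b, hb, hmin⟩

/-- The least squares estimator over the interval `[-a, a]`. -/
noncomputable def intervalLSE (a : ℝ) : EuclideanSpace ℝ (Fin 1) → EuclideanSpace ℝ (Fin 1) :=
  penalizedLSE (Metric.closedBall (0 : EuclideanSpace ℝ (Fin 1)) a) (fun _ ↦ 0)

lemma intervalLSE_variational {a : ℝ} (ha : 0 ≤ a) (x : EuclideanSpace ℝ (Fin 1)) {t : ℝ}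
    (ht : |t| ≤ a) : (x 0 - intervalLSE a x 0) * (t - intervalLSE a x 0) ≤ 0 := by
  have hf := zero_mem_penalties_closedBall (n := 1) ha
  have h := inner_le_of_isPenalizedMin hf.1 (isPenalizedMin_penalizedLSE hf x)
    (α := WithLp.toLp 2 fun _ ↦ t) (by simpa [norm_eq_abs_apply_zero] using ht)
  simp only [PiLp.inner_apply, Fin.sum_univ_one, PiLp.sub_apply, sub_self] at h
  simpa [intervalLSE, mul_comm] using h

lemma abs_intervalLSE_le {a : ℝ} (ha : 0 ≤ a) (x : EuclideanSpace ℝ (Fin 1)) :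
    |intervalLSE a x 0| ≤ a := by
  simpa [norm_eq_abs_apply_zero, intervalLSE] using
    penalizedLSE_mem (zero_mem_penalties_closedBall (n := 1) ha) x

lemma intervalLSE_of_gt {a : ℝ} (ha : 0 ≤ a) {x : EuclideanSpace ℝ (Fin 1)} (hx : a < x 0) :
    intervalLSE a x 0 = a := by
  have h1 := intervalLSE_variational ha x (t := a) (abs_of_nonneg ha).le
  have h2 := (abs_le.1 (abs_intervalLSE_le ha x)).2
  nlinarith

lemma intervalLSE_of_lt {a : ℝ} (ha : 0 ≤ a) {x : EuclideanSpace ℝ (Fin 1)} (hx : x 0 < -a) :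
    intervalLSE a x 0 = -a := by
  have h1 := intervalLSE_variational ha x (t := -a) (by rw [abs_neg, abs_of_nonneg ha])
  have h2 := (abs_le.1 (abs_intervalLSE_le ha x)).1
  nlinarith

lemma stdGaussian_lt_neg (u : ℝ) :
    stdGaussian (EuclideanSpace ℝ (Fin 1)) {z | z 0 < -u} =
      stdGaussian (EuclideanSpace ℝ (Fin 1)) {z | u < z 0} := by
  have h := stdGaussian_map (LinearIsometryEquiv.neg ℝ (E := EuclideanSpace ℝ (Fin 1)))
  conv_rhs => rw [← h]
  rw [Measure.map_apply (by fun_prop) (measurableSet_lt measurable_const (by fun_prop))]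
  congr 1
  ext z
  simp [lt_neg]

/-- Noise beyond `±2a` pushes the observation out of the interval whatever `θ` is, so the estimate
is the corresponding endpoint; the two squared errors sum to `2 a ^ 2 + 2 θ ^ 2`. -/
lemma le_risk_intervalLSE {a : ℝ} (ha : 0 ≤ a) {θ : EuclideanSpace ℝ (Fin 1)} (hθ : ‖θ‖ ≤ a) :
    ENNReal.ofReal (2 * a ^ 2 + 2 * θ 0 ^ 2) *
      stdGaussian (EuclideanSpace ℝ (Fin 1)) {z | 2 * a < z 0} ≤ risk (intervalLSE a) θ := by
  rw [norm_eq_abs_apply_zero, abs_le] at hθ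
  have hm : Measurable (intervalLSE a) :=
    measurable_penalizedLSE (zero_mem_penalties_closedBall ha)
  have hA : MeasurableSet {z : EuclideanSpace ℝ (Fin 1) | 2 * a < z 0} :=
    measurableSet_lt measurable_const (by fun_prop)
  have hB : MeasurableSet {z : EuclideanSpace ℝ (Fin 1) | z 0 < -(2 * a)} :=
    measurableSet_lt (by fun_prop) measurable_const
  have hdisj : Disjoint {z : EuclideanSpace ℝ (Fin 1) | 2 * a < z 0} {z | z 0 < -(2 * a)} := by
    rw [Set.disjoint_left]
    intro z h1 h2
    simp only [Set.mem_ofPred_eq] at h1 h2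
    linarith
  rw [risk_eq_lintegral hm]
  calc _ = ENNReal.ofReal ((a - θ 0) ^ 2) *
          stdGaussian (EuclideanSpace ℝ (Fin 1)) {z | 2 * a < z 0} +
        ENNReal.ofReal ((a + θ 0) ^ 2) *
          stdGaussian (EuclideanSpace ℝ (Fin 1)) {z | z 0 < -(2 * a)} := by
        rw [stdGaussian_lt_neg, ← add_mul, ← ENNReal.ofReal_add (by positivity) (by positivity)]
        ring_nf
    _ = ∫⁻ z in {z | 2 * a < z 0}, ENNReal.ofReal ((a - θ 0) ^ 2)
          ∂stdGaussian (EuclideanSpace ℝ (Fin 1)) +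
        ∫⁻ z in {z | z 0 < -(2 * a)}, ENNReal.ofReal ((a + θ 0) ^ 2)
          ∂stdGaussian (EuclideanSpace ℝ (Fin 1)) := by
        rw [setLIntegral_const, setLIntegral_const]
    _ ≤ ∫⁻ z in {z | 2 * a < z 0}, ENNReal.ofReal (‖intervalLSE a (θ + z) - θ‖ ^ 2)
          ∂stdGaussian (EuclideanSpace ℝ (Fin 1)) +
        ∫⁻ z in {z | z 0 < -(2 * a)}, ENNReal.ofReal (‖intervalLSE a (θ + z) - θ‖ ^ 2)
          ∂stdGaussian (EuclideanSpace ℝ (Fin 1)) := by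
        refine add_le_add (setLIntegral_mono' hA fun z hz ↦ ?_)
          (setLIntegral_mono' hB fun z hz ↦ ?_)
        · simp only [Set.mem_ofPred_eq] at hz
          rw [norm_eq_abs_apply_zero, sq_abs, PiLp.sub_apply,
            intervalLSE_of_gt ha (by rw [PiLp.add_apply]; linarith)]
        · simp only [Set.mem_ofPred_eq] at hz
          rw [norm_eq_abs_apply_zero, sq_abs, PiLp.sub_apply,
            intervalLSE_of_lt ha (by rw [PiLp.add_apply]; linarith)]
          exact ENNReal.ofReal_le_ofReal (by nlinarith)
    _ ≤ _ := by
        rw [← lintegral_union hB hdisj]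
        exact setLIntegral_le_lintegral _ _

/-- The zero estimator is the witness: its risk is `θ ^ 2`, and `θ ^ 2 ≤ a ^ 2` gives `2 a ^ 2 + 2 θ
^ 2 ≥ 4 θ ^ 2`. -/
lemma normalizedMinimaxRisk_interval_le {a : ℝ} (ha : 0 < a)
    (hq : stdGaussian (EuclideanSpace ℝ (Fin 1)) {z | 2 * a < z 0} ≠ 0) :
    normalizedMinimaxRisk (Metric.closedBall (0 : EuclideanSpace ℝ (Fin 1)) a) (fun _ ↦ 0) ≤
      (4 * stdGaussian (EuclideanSpace ℝ (Fin 1)) {z | 2 * a < z 0})⁻¹ := by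
  set q := stdGaussian (EuclideanSpace ℝ (Fin 1)) {z | 2 * a < z 0} with hqdef
  have hqt : q ≠ ∞ := measure_ne_top _ _
  refine iInf₂_le_of_le (fun _ ↦ 0) measurable_const (iSup₂_le fun θ hθ ↦ ?_)
  rw [mem_closedBall_zero_iff] at hθ
  have hle := le_risk_intervalLSE ha.le hθ
  rw [← hqdef] at hle
  change riskRatio _ (risk (intervalLSE a) θ) ≤ _
  have hne : risk (intervalLSE a) θ ≠ 0 := by
    refine (lt_of_lt_of_le ?_ hle).ne'
    refine ENNReal.mul_pos ?_ hq
    rw [Ne, ENNReal.ofReal_eq_zero, not_le]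
    positivity
  rw [riskRatio, if_neg (by tauto)]
  refine ENNReal.div_le_of_le_mul ?_
  have hr : risk (fun _ ↦ 0) θ = ENNReal.ofReal (θ 0 ^ 2) := by
    rw [risk_eq_lintegral measurable_const]
    simp [norm_eq_abs_apply_zero]
  have h4 : 4 * q * ENNReal.ofReal (θ 0 ^ 2) ≤ risk (intervalLSE a) θ := by
    refine le_trans ?_ hle
    rw [mul_right_comm, ← ENNReal.ofReal_ofNat 4, ← ENNReal.ofReal_mul (by norm_num)]
    gcongr
    rw [norm_eq_abs_apply_zero] at hθ
    have := sq_le_sq' (by linarith [neg_abs_le (θ 0), abs_nonneg (θ 0)])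
      ((le_abs_self _).trans hθ)
    linarith
  rw [hr, mul_comm, ← div_eq_mul_inv, ENNReal.le_div_iff_mul_le (Or.inl (by simpa using hq))
    (Or.inl (ENNReal.mul_ne_top (by norm_num) hqt)), mul_comm]
  exact h4

/-- The Gaussian measure has no atom at `0`, so small balls have small mass; symmetry splits the
rest equally between the two tails. -/
lemma exists_measure_gt_ge {ε : ℝ} (hε : 0 < ε) :
    ∃ a > 0, ENNReal.ofReal (1 - ε) ≤
      2 * stdGaussian (EuclideanSpace ℝ (Fin 1)) {z | 2 * a < z 0} := by
  have h0 : stdGaussian (EuclideanSpace ℝ (Fin 1)) {0} < ENNReal.ofReal ε := by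
    rw [stdGaussian_absolutelyContinuous (measure_singleton 0)]
    exact ENNReal.ofReal_pos.2 hε
  obtain ⟨U, hU, hUo, hUε⟩ := Set.exists_isOpen_lt_of_lt _ _ h0
  obtain ⟨ρ, hρ, hρU⟩ := Metric.nhds_basis_closedBall.mem_iff.1
    (hUo.mem_nhds (hU (Set.mem_singleton 0)))
  refine ⟨ρ / 2, by positivity, ?_⟩
  rw [show 2 * (ρ / 2) = ρ by ring]
  have hcover : (Set.univ : Set (EuclideanSpace ℝ (Fin 1))) ⊆
      ({z | ρ < z 0} ∪ {z | z 0 < -ρ}) ∪ U := by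
    intro z _
    by_cases h1 : ρ < z 0
    · exact Or.inl (Or.inl h1)
    by_cases h2 : z 0 < -ρ
    · exact Or.inl (Or.inr h2)
    · refine Or.inr (hρU ?_)
      rw [mem_closedBall_zero_iff, norm_eq_abs_apply_zero, abs_le]
      exact ⟨not_lt.1 h2, not_lt.1 h1⟩
  have h1 : (1 : ℝ≥0∞) ≤
      2 * stdGaussian (EuclideanSpace ℝ (Fin 1)) {z | ρ < z 0} + ENNReal.ofReal ε := by
    calc (1 : ℝ≥0∞) = stdGaussian (EuclideanSpace ℝ (Fin 1)) Set.univ := measure_univ.symm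
      _ ≤ _ := (measure_mono hcover).trans ((measure_union_le _ _).trans
          (add_le_add_left (measure_union_le _ _) _))
      _ ≤ _ := by rw [stdGaussian_lt_neg, two_mul]; gcongr
  rw [ENNReal.ofReal_sub _ hε.le, ENNReal.ofReal_one]
  exact tsub_le_iff_right.2 h1

theorem Cstar_le_half : Cstar ≤ 1 / 2 := by
  have hkey {ε : ℝ} (hε : 0 < ε) (hε1 : ε < 1) : Cstar ≤ ENNReal.ofReal (1 / (2 * (1 - ε))) := by
    obtain ⟨a, ha, hq⟩ := exists_measure_gt_ge hε
    set q := stdGaussian (EuclideanSpace ℝ (Fin 1)) {z | 2 * a < z 0} with hqdef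
    have hq0 : q ≠ 0 := by
      intro h
      rw [h, mul_zero, nonpos_iff_eq_zero, ENNReal.ofReal_eq_zero] at hq
      linarith
    calc Cstar ≤ normalizedMinimaxRisk (Metric.closedBall (0 : EuclideanSpace ℝ (Fin 1)) a)
          (fun _ ↦ 0) :=
          iInf₂_le_of_le 1 le_rfl (iInf₂_le_of_le _ (closedBall_mem_parameterSets ha.le)
            (iInf₂_le _ (zero_mem_penalties_closedBall ha.le)))
      _ ≤ (4 * q)⁻¹ := normalizedMinimaxRisk_interval_le ha hq0
      _ ≤ (ENNReal.ofReal (2 * (1 - ε)))⁻¹ := by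
          rw [ENNReal.inv_le_inv, ENNReal.ofReal_mul (by norm_num), ENNReal.ofReal_ofNat]
          calc 2 * ENNReal.ofReal (1 - ε) ≤ 2 * (2 * q) := by gcongr
            _ = 4 * q := by ring
      _ = _ := by
          rw [one_div, ENNReal.ofReal_inv_of_pos (by linarith)]
  have htop : Cstar ≠ ∞ :=
    ne_top_of_le_ne_top ENNReal.ofReal_ne_top (hkey (ε := 1 / 2) (by norm_num) (by norm_num))
  have hreal : Cstar.toReal ≤ 1 / 2 := by
    by_contra! hx
    set x := Cstar.toReal
    -- With this `ε` the bound `x * (2 * (1 - ε)) ≤ 1` reads `x + 1 / 2 ≤ 1`, contradicting `x > 1 /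
    -- 2`.
    have hε : 0 < (2 * x - 1) / (4 * x) := div_pos (by linarith) (by linarith)
    have hε1 : (2 * x - 1) / (4 * x) < 1 := by rw [div_lt_one (by linarith)]; linarith
    have h := ENNReal.toReal_le_of_le_ofReal (by
      refine div_nonneg zero_le_one ?_; linarith) (hkey hε hε1)
    rw [le_div_iff₀ (by linarith)] at h
    have e : x * (2 * (1 - (2 * x - 1) / (4 * x))) = x + 1 / 2 := by
      have : x ≠ 0 := by linarith
      field_simp
      ring
    linarith
  rw [← ENNReal.ofReal_toReal htop]
  refine (ENNReal.ofReal_le_ofReal hreal).trans_eq ?_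
  rw [one_div, ENNReal.ofReal_inv_of_pos (by norm_num), ENNReal.ofReal_ofNat, one_div]

end UpperBound

end GaussianSequence

theorem theorem3 :
    ENNReal.ofReal (6.05 * 10 ^ (-6 : ℤ)) ≤ GaussianSequence.Cstar ∧
      GaussianSequence.Cstar ≤ 1 / 2 := by
  refine ⟨?_, GaussianSequence.Cstar_le_half⟩
  exact le_iInf₂ fun _ _ ↦ le_iInf₂ fun _ hΘ ↦ le_iInf₂ fun _ hf ↦
    GaussianSequence.le_normalizedMinimaxRisk hΘ hf
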